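/- Let $n_1,n_2\in\mathbb N$ and let $\Omega_j\subset\mathbb R^{n_j}$ ($j=1,2$) be bounded open sets. For a bounded open set $\Omega\subset\mathbb R^n$ and $\Lambda>0$, let $\Pi_\Lambda$ be the orthogonal projection of the real space $L^2(\Omega)$ onto the span of the eigenfunctions of the Dirichlet Laplacian $-\Delta$ on $\Omega$ with eigenvalue at most $\Lambda$, that is, $\Pi_\Lambda u=\sum_{\lambda_k\le\Lambda}\langle u,\varphi_k\rangle_{L^2}\varphi_k$, where $(\varphi_k)$ is an orthonormal basis of $L^2(\Omega)$ with $\varphi_k\in H_0^1(\Omega)$ and $-\Delta\varphi_k=\lambda_k\varphi_k$ weakly in $\Omega$. The function $\Pi_\Lambda u$ is identified with its continuous representative on $\Omega$. For $\omega\subset\Omega$ and $C,\beta>0$, say that $\mathrm{spec}(\Omega,\omega,C,\beta)$ holds if $$\|\Pi_\Lambda u\|_{L^2(\Omega)}\le C\exp(C\Lambda^\beta)\,\sup_{x\in\omega}|\Pi_\Lambda u(x)|\qquad\text{for all }\Lambda>0\text{ and all }u\in L^2(\Omega)$$ (the supremum being taken in $[0,\infty]$, and equal to $0$ if $\omega=\emptyset$).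 Let $C,\beta>0$. (i) Let $\omega\subset\Omega_1\times\Omega_2$, let $\omega_2=\pi_2(\omega)$ be the projection of $\omega$ on $\Omega_2$ and, for $y\in\omega_2$, let $\omega_y=\pi_1\big(\omega\cap(\Omega_1\times\{y\})\big)$ be the horizontal slice of $\omega$ at $y$. If $\mathrm{spec}(\Omega_2,\omega_2,C,\beta)$ holds and $\mathrm{spec}(\Omega_1,\omega_y,C,\beta)$ holds for every $y\in\omega_2$, then there exists $C'>0$ such that $\mathrm{spec}(\Omega_1\times\Omega_2,\omega,C',\beta)$ holds. (ii) In particular, if $\omega_j\subset\Omega_j$ and $\mathrm{spec}(\Omega_j,\omega_j,C,\beta)$ holds for $j=1,2$, then there exists $C'>0$ such that $\mathrm{spec}(\Omega_1\times\Omega_2,\omega_1\times\omega_2,C',\beta)$ holds. -/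

import Mathlib

open MeasureTheory

/-- The space `L²(Ω)` of real square-integrable functions on `Ω ⊆ ℝ^ι` (Lebesgue measure). -/
abbrev L2 {ι : Type*} [Fintype ι] (Ω : Set (EuclideanSpace ℝ ι)) : Type _ :=
  Lp ℝ 2 ((volume : Measure (EuclideanSpace ℝ ι)).restrict Ω)

/-- `φ ∈ C_c^∞(Ω)`. -/
def IsTestFunction {ι : Type*} [Fintype ι] (Ω : Set (EuclideanSpace ℝ ι))
    (φ : EuclideanSpace ℝ ι → ℝ) : Prop :=
  ContDiff ℝ (⊤ : ℕ∞) φ ∧ HasCompactSupport φ ∧ tsupport φ ⊆ Ω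

/-- The classical partial derivative `∂ᵢ φ`. -/
noncomputable def partialDeriv {ι : Type*} [Fintype ι] [DecidableEq ι] (i : ι)
    (φ : EuclideanSpace ℝ ι → ℝ) (x : EuclideanSpace ℝ ι) : ℝ :=
  fderiv ℝ φ x (EuclideanSpace.single i 1)

/-- The pairs `(φ, ∇φ)` with `φ ∈ C_c^∞(Ω)`, seen in `L²(Ω) × L²(Ω)^ι`. -/
def testGraph {ι : Type*} [Fintype ι] [DecidableEq ι] (Ω : Set (EuclideanSpace ℝ ι)) :
    Set (L2 Ω × (ι → L2 Ω)) :=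
  {p | ∃ φ : EuclideanSpace ℝ ι → ℝ, IsTestFunction Ω φ ∧
    p.1 =ᵐ[volume.restrict Ω] φ ∧ ∀ i, p.2 i =ᵐ[volume.restrict Ω] partialDeriv i φ}

/-- `u ∈ H₀¹(Ω)` with weak gradient `G`: since `H₀¹(Ω)` is the closure of `C_c^∞(Ω)` for the norm
`(‖u‖² + ‖∇u‖²)^{1/2}`, this says that `(u, G)` is a limit in `L²(Ω) × L²(Ω)^ι` of pairs
`(φ, ∇φ)` with `φ ∈ C_c^∞(Ω)`. -/
def IsH10WithGradient {ι : Type*} [Fintype ι] [DecidableEq ι] (Ω : Set (EuclideanSpace ℝ ι))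
    (u : L2 Ω) (G : ι → L2 Ω) : Prop :=
  (u, G) ∈ closure (testGraph Ω)

/-- `u` belongs to the eigenspace of the Dirichlet Laplacian `-Δ` on `Ω` for the number `μ`:
`u ∈ H₀¹(Ω)` and `∫ ∇u · ∇v = μ ∫ u v` for every `v ∈ C_c^∞(Ω)`.
(The zero function is allowed; this does not affect spans.) -/
def IsDirichletEigenfunction {ι : Type*} [Fintype ι] [DecidableEq ι]
    (Ω : Set (EuclideanSpace ℝ ι)) (μ : ℝ) (u : L2 Ω) : Prop :=
  ∃ G : ι → L2 Ω, IsH10WithGradient Ω u G ∧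
    ∀ v : EuclideanSpace ℝ ι → ℝ, IsTestFunction Ω v →
      ∑ i, ∫ x in Ω, G i x * partialDeriv i v x = μ * ∫ x in Ω, u x * v x

/-- The closed linear span in `L²(Ω)` of the Dirichlet eigenfunctions with eigenvalue `≤ Λ`. -/
noncomputable def lowFrequencySpace {ι : Type*} [Fintype ι] [DecidableEq ι]
    (Ω : Set (EuclideanSpace ℝ ι)) (Λ : ℝ) : Submodule ℝ (L2 Ω) :=
  (Submodule.span ℝ {φ : L2 Ω | ∃ μ ≤ Λ, IsDirichletEigenfunction Ω μ φ}).topologicalClosure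

instance lowFrequencySpace_hasOrthogonalProjection {ι : Type*} [Fintype ι] [DecidableEq ι]
    (Ω : Set (EuclideanSpace ℝ ι)) (Λ : ℝ) : (lowFrequencySpace Ω Λ).HasOrthogonalProjection := by
  unfold lowFrequencySpace
  infer_instance

/-- The spectral projector `Π_Λ u = ∑_{λ_k ≤ Λ} ⟨u, φ_k⟩ φ_k`, i.e. the orthogonal projection of
`L²(Ω)` onto the span of the eigenfunctions with eigenvalue at most `Λ`. -/
noncomputable def spectralProjector {ι : Type*} [Fintype ι] [DecidableEq ι]
    (Ω : Set (EuclideanSpace ℝ ι)) (Λ : ℝ) : L2 Ω →L[ℝ] L2 Ω :=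
  (lowFrequencySpace Ω Λ).starProjection

/-- `spec(Ω, ω, C, β)`, for `ω ⊆ Ω` and `Ω` open: for all `Λ > 0` and `u ∈ L²(Ω)`,
`‖Π_Λ u‖_{L²(Ω)} ≤ C exp(C Λ^β) sup_{x ∈ ω} |Π_Λ u (x)|`.
The pointwise values of `Π_Λ u` are those of its continuous representative `f`, which is unique
on the open set `Ω`; the supremum is taken in `[0, ∞]`, with value `0` for empty `ω`. -/
def SpectralInequality {ι : Type*} [Fintype ι] [DecidableEq ι]
    (Ω ω : Set (EuclideanSpace ℝ ι)) (C β : ℝ) : Prop :=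
  ∀ Λ : ℝ, 0 < Λ → ∀ u : L2 Ω, ∃ f : EuclideanSpace ℝ ι → ℝ,
    ContinuousOn f Ω ∧ spectralProjector Ω Λ u =ᵐ[volume.restrict Ω] f ∧
    ENNReal.ofReal ‖spectralProjector Ω Λ u‖ ≤
      ENNReal.ofReal (C * Real.exp (C * Λ ^ β)) * ⨆ x ∈ ω, ENNReal.ofReal |f x|

/-- The first projection `π₁ : ℝ^{n₁} × ℝ^{n₂} → ℝ^{n₁}`, with `ℝ^{n₁} × ℝ^{n₂}` realised as the
Euclidean space over the disjoint union of the two index sets. -/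
def proj₁ {ι₁ ι₂ : Type*} (z : EuclideanSpace ℝ (ι₁ ⊕ ι₂)) : EuclideanSpace ℝ ι₁ :=
  WithLp.toLp 2 fun i => z (Sum.inl i)

/-- The second projection `π₂ : ℝ^{n₁} × ℝ^{n₂} → ℝ^{n₂}`. -/
def proj₂ {ι₁ ι₂ : Type*} (z : EuclideanSpace ℝ (ι₁ ⊕ ι₂)) : EuclideanSpace ℝ ι₂ :=
  WithLp.toLp 2 fun j => z (Sum.inr j)

/-- The Cartesian product `A × B ⊆ ℝ^{n₁} × ℝ^{n₂}`. -/
def cartesian {ι₁ ι₂ : Type*} (A : Set (EuclideanSpace ℝ ι₁)) (B : Set (EuclideanSpace ℝ ι₂)) :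
    Set (EuclideanSpace ℝ (ι₁ ⊕ ι₂)) :=
  {z | proj₁ z ∈ A ∧ proj₂ z ∈ B}

/-- The horizontal slice `ω_y = π₁(ω ∩ (Ω₁ × {y}))`. -/
def horizontalSlice {ι₁ ι₂ : Type*} (Ω₁ : Set (EuclideanSpace ℝ ι₁))
    (ω : Set (EuclideanSpace ℝ (ι₁ ⊕ ι₂))) (y : EuclideanSpace ℝ ι₂) :
    Set (EuclideanSpace ℝ ι₁) :=
  proj₁ '' (ω ∩ cartesian Ω₁ {y})

/-!
Let `E_Λ(Ω)` be the span of the Dirichlet eigenfunctions on `Ω` with eigenvalue at most `Λ`. The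
proof rests on two facts about `E_Λ`.

* Its dimension is at most polynomial in `Λ` (`exists_finrank_span_le`). By a Poincaré inequality
  on a grid of cubes (`sum_gridCell_lintegral_le`, a consequence of the bound of
  `‖φ(· + t) - φ‖` by `‖t‖ ‖∇φ‖`), the step functions on a grid of mesh `R / m` approximate
  `H₀¹(Ω)` in `L²(Ω)` with error `O(1 / m)` times the norm of the gradient, so the projection onto
  these step functions is injective on `E_Λ(Ω)` as soon as `m` exceeds a multiple of `Λ`.
* Every element of `E_Λ(Ω₁ × Ω₂)` is a finite sum `∑ φ_k ⊗ a_k` with `(φ_k)` an orthonormal basis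
  of `E_Λ(Ω₁)` and `a_k ∈ E_Λ(Ω₂)` (`exists_eq_sum_tensorLp`). The same approximation makes the
  resolvent `(1 - Δ)⁻¹` compact, hence the eigenfunctions on a bounded open set are total
  (`eq_zero_of_inner_dirichletEigenfunction`), hence so are the products `φ ⊗ ψ` of eigenfunctions
  on the two factors. Such a product is an eigenfunction whose eigenvalue is the sum of the two
  (`IsDirichletEigenfunction.tensorLp`); since eigenvalues are nonnegative and eigenspaces are
  orthogonal, only products of low frequencies contribute to `E_Λ(Ω₁ × Ω₂)`.

Now let `f = ∑ φ_k ⊗ a_k` be low-frequency and let `K = C exp(C Λ^β)`. For `y` in the projection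
of `ω`, the inequality on `Ω₁` applied to `f(·, y)` gives
`|a_k(y)| ≤ ‖f(·, y)‖ ≤ K sup_ω |f|`. The inequality on `Ω₂` applied to `a_k` then gives
`‖a_k‖ ≤ K² sup_ω |f|`. Summing over `k` costs a factor `dim E_Λ(Ω₁)`, which is polynomial in `Λ`
and therefore absorbed by the exponential (`SpectralInequality.of_slices`).
-/

open scoped ENNReal RealInnerProductSpace

/-! ### Translations and oscillation -/

theorem sq_lintegral_le_mul_lintegral_sq {α : Type*} [MeasurableSpace α] (μ : Measure α)
    {f : α → ℝ≥0∞} (hf : AEMeasurable f μ) :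
    (∫⁻ x, f x ∂μ) ^ 2 ≤ μ Set.univ * ∫⁻ x, f x ^ 2 ∂μ := by
  have h := ENNReal.lintegral_mul_le_Lp_mul_Lq μ Real.HolderConjugate.two_two
    (f := fun _ => 1) (g := f) aemeasurable_const hf
  have h2 := pow_le_pow_left' h 2
  simp only [Pi.mul_apply, one_mul, ENNReal.one_rpow, lintegral_const, mul_pow] at h2
  refine h2.trans (le_of_eq ?_)
  rw [← ENNReal.rpow_natCast, ← ENNReal.rpow_natCast, ← ENNReal.rpow_mul, ← ENNReal.rpow_mul]
  norm_num

/-- A linear functional on Euclidean space is bounded by the Euclidean norm of its coefficients. -/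
theorem sq_enorm_fderiv_le {ι : Type*} [Fintype ι] [DecidableEq ι]
    (L : EuclideanSpace ℝ ι →L[ℝ] ℝ) (v : EuclideanSpace ℝ ι) :
    ‖L v‖ₑ ^ 2 ≤ ‖v‖ₑ ^ 2 * ∑ i, ‖L (EuclideanSpace.single i 1)‖ₑ ^ 2 := by
  have h1 : L v = ∑ i, v i * L (EuclideanSpace.single i 1) := by
    conv_lhs => rw [← (EuclideanSpace.basisFun ι ℝ).sum_repr v]
    simp
  have h2 : (L v) ^ 2 ≤ ‖v‖ ^ 2 * ∑ i, (L (EuclideanSpace.single i 1)) ^ 2 := by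
    rw [h1, EuclideanSpace.real_norm_sq_eq]
    exact Finset.sum_mul_sq_le_sq_mul_sq _ _ _
  have h3 : ∀ r : ℝ, ‖r‖ₑ ^ 2 = ENNReal.ofReal (r ^ 2) := fun r => by
    rw [← ofReal_norm, ← ENNReal.ofReal_pow (norm_nonneg _), Real.norm_eq_abs, sq_abs]
  have h4 : ‖v‖ₑ ^ 2 = ENNReal.ofReal (‖v‖ ^ 2) := by
    rw [← ofReal_norm, ← ENNReal.ofReal_pow (norm_nonneg _)]
  rw [h3, h4]
  simp only [h3]
  rw [← ENNReal.ofReal_sum_of_nonneg (fun i _ => sq_nonneg _), ← ENNReal.ofReal_mul (by positivity)]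
  exact ENNReal.ofReal_le_ofReal h2

theorem sq_enorm_sub_le_lintegral_fderiv {E : Type*} [NormedAddCommGroup E] [NormedSpace ℝ E]
    {φ : E → ℝ} (hφ : ContDiff ℝ 1 φ) (x t : E) :
    ‖φ (x + t) - φ x‖ₑ ^ 2 ≤ ∫⁻ s in Set.Ioc (0 : ℝ) 1, ‖fderiv ℝ φ (x + s • t) t‖ₑ ^ 2 := by
  have hd : ∀ s ∈ Set.uIcc (0 : ℝ) 1,
      HasDerivAt (fun s : ℝ => φ (x + s • t)) (fderiv ℝ φ (x + s • t) t) s := by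
    intro s _
    have h1 : HasDerivAt (fun s : ℝ => x + s • t) t s := by
      simpa using ((hasDerivAt_id s).smul_const t).const_add x
    exact ((hφ.differentiable (by norm_num)) _).hasFDerivAt.comp_hasDerivAt s h1
  have hc : Continuous fun s : ℝ => fderiv ℝ φ (x + s • t) t :=
    ((hφ.continuous_fderiv (by norm_num)).comp (by fun_prop)).clm_apply continuous_const
  have h := intervalIntegral.integral_eq_sub_of_hasDerivAt hd (hc.intervalIntegrable 0 1)
  simp only [one_smul, zero_smul, add_zero] at h
  rw [← h, intervalIntegral.integral_of_le zero_le_one]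
  refine (pow_le_pow_left' (enorm_integral_le_lintegral_enorm _) 2).trans ?_
  refine (sq_lintegral_le_mul_lintegral_sq _ hc.enorm.measurable.aemeasurable).trans ?_
  simp

/-- `‖φ(· + t) - φ‖² ≤ ‖t‖² ‖∇φ‖²`, by integrating `∇φ` along the segments from `x` to `x + t`. -/
theorem lintegral_sq_enorm_translate_sub_le {ι : Type*} [Fintype ι] [DecidableEq ι]
    {φ : EuclideanSpace ℝ ι → ℝ} (hφ : ContDiff ℝ 1 φ) (t : EuclideanSpace ℝ ι) :
    ∫⁻ x, ‖φ (x + t) - φ x‖ₑ ^ 2 ≤ ‖t‖ₑ ^ 2 * ∑ i, ∫⁻ x, ‖partialDeriv i φ x‖ₑ ^ 2 := by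
  have hc : Continuous (fderiv ℝ φ) := hφ.continuous_fderiv (by norm_num)
  have hm : ∀ i, Measurable fun x => ‖partialDeriv i φ x‖ₑ ^ 2 := fun i =>
    (((hc.clm_apply continuous_const).enorm).measurable).pow_const 2
  calc ∫⁻ x, ‖φ (x + t) - φ x‖ₑ ^ 2
      ≤ ∫⁻ x, ∫⁻ s in Set.Ioc (0 : ℝ) 1, ‖fderiv ℝ φ (x + s • t) t‖ₑ ^ 2 :=
        lintegral_mono fun x => sq_enorm_sub_le_lintegral_fderiv hφ x t
    _ = ∫⁻ s in Set.Ioc (0 : ℝ) 1, ∫⁻ x, ‖fderiv ℝ φ (x + s • t) t‖ₑ ^ 2 := by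
        refine lintegral_lintegral_swap ?_
        have : Continuous fun p : EuclideanSpace ℝ ι × ℝ => fderiv ℝ φ (p.1 + p.2 • t) t :=
          (hc.comp (by fun_prop)).clm_apply continuous_const
        exact (this.enorm.measurable.pow_const 2).aemeasurable
    _ = ∫⁻ s in Set.Ioc (0 : ℝ) 1, ∫⁻ x, ‖fderiv ℝ φ x t‖ₑ ^ 2 := by
        congr 1; ext s
        exact lintegral_add_right_eq_self (fun x => ‖fderiv ℝ φ x t‖ₑ ^ 2) (s • t)
    _ = ∫⁻ x, ‖fderiv ℝ φ x t‖ₑ ^ 2 := by simp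
    _ ≤ ∫⁻ x, ‖t‖ₑ ^ 2 * ∑ i, ‖partialDeriv i φ x‖ₑ ^ 2 :=
        lintegral_mono fun x => sq_enorm_fderiv_le _ _
    _ = ‖t‖ₑ ^ 2 * ∑ i, ∫⁻ x, ‖partialDeriv i φ x‖ₑ ^ 2 := by
        rw [lintegral_const_mul _ (Finset.measurable_sum _ fun i _ => hm i),
          lintegral_finsetSum _ fun i _ => hm i]

/-- The deviation of `φ` from its average over `Q` is at most the mean of the differences
`φ y - φ x` over pairs of points of `Q`. -/
theorem lintegral_sq_enorm_sub_average_le {α : Type*} [MeasurableSpace α] {μ : Measure α}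
    {Q : Set α} (h0 : μ Q ≠ 0) (hfin : μ Q ≠ ∞) {φ : α → ℝ} (hφ : IntegrableOn φ Q μ)
    (hm : Measurable φ) :
    ∫⁻ x in Q, ‖φ x - ⨍ y in Q, φ y ∂μ‖ₑ ^ 2 ∂μ ≤
      (μ Q)⁻¹ * ∫⁻ x in Q, ∫⁻ y in Q, ‖φ y - φ x‖ₑ ^ 2 ∂μ ∂μ := by
  have hfin' : (μ.restrict Q) Set.univ = μ Q := Measure.restrict_apply_univ Q
  have : IsFiniteMeasure (μ.restrict Q) := ⟨by rw [hfin']; exact hfin.lt_top⟩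
  have hr : (μ.real Q) ≠ 0 := by
    rw [Measure.real, ENNReal.toReal_ne_zero]; exact ⟨h0, hfin⟩
  rw [← lintegral_const_mul' _ _ (ENNReal.inv_ne_top.2 h0)]
  refine lintegral_mono fun x => ?_
  have h1 : φ x - ⨍ y in Q, φ y ∂μ = (μ.real Q)⁻¹ * ∫ y in Q, (φ x - φ y) ∂μ := by
    rw [setAverage_eq, integral_sub (integrable_const _) hφ, setIntegral_const]
    simp only [smul_eq_mul]
    field_simp
  have h2 : ‖(μ.real Q)⁻¹‖ₑ = (μ Q)⁻¹ := by
    rw [enorm_inv hr, Real.enorm_of_nonneg measureReal_nonneg, ofReal_measureReal hfin]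
  rw [h1, enorm_mul, mul_pow, h2]
  have h3 : ‖∫ y in Q, (φ x - φ y) ∂μ‖ₑ ^ 2 ≤ μ Q * ∫⁻ y in Q, ‖φ y - φ x‖ₑ ^ 2 ∂μ := by
    refine (pow_le_pow_left' (enorm_integral_le_lintegral_enorm _) 2).trans ?_
    refine (sq_lintegral_le_mul_lintegral_sq _
      ((measurable_const.sub hm).enorm.aemeasurable)).trans ?_
    rw [hfin']
    exact le_of_eq (congrArg _ (lintegral_congr fun y => by
      rw [enorm_sub_rev (φ y)]; rfl))
  calc (μ Q)⁻¹ ^ 2 * ‖∫ y in Q, (φ x - φ y) ∂μ‖ₑ ^ 2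
      ≤ (μ Q)⁻¹ ^ 2 * (μ Q * ∫⁻ y in Q, ‖φ y - φ x‖ₑ ^ 2 ∂μ) := by gcongr
    _ = ((μ Q)⁻¹ * μ Q) * ((μ Q)⁻¹ * ∫⁻ y in Q, ‖φ y - φ x‖ₑ ^ 2 ∂μ) := by ring
    _ = _ := by rw [ENNReal.inv_mul_cancel h0 hfin, one_mul]

/-- Poincaré inequality summed over disjoint sets `Q k` of equal volume `v`: two points of `Q k`
differ by a translation in `B`, so that the oscillations are controlled by translations of `φ`. -/
theorem sum_lintegral_sq_enorm_sub_average_le {ι κ : Type*} [Fintype ι] [DecidableEq ι]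
    {Q : κ → Set (EuclideanSpace ℝ ι)} (s : Finset κ) (hQm : ∀ k, MeasurableSet (Q k))
    (hd : Pairwise (Function.onFun Disjoint Q)) {v : ℝ≥0∞} (hv0 : v ≠ 0) (hv : v ≠ ∞)
    (hQv : ∀ k, volume (Q k) = v) {r : ℝ≥0∞} {B : Set (EuclideanSpace ℝ ι)}
    (hB : MeasurableSet B) (hBr : ∀ t ∈ B, ‖t‖ₑ ^ 2 ≤ r)
    (hQr : ∀ k, ∀ x ∈ Q k, ∀ y ∈ Q k, y - x ∈ B)
    {φ : EuclideanSpace ℝ ι → ℝ} (hφ : ContDiff ℝ 1 φ) (hc : HasCompactSupport φ) :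
    ∑ k ∈ s, ∫⁻ x in Q k, ‖φ x - ⨍ y in Q k, φ y‖ₑ ^ 2 ≤
      v⁻¹ * (volume B * (r * ∑ i, ∫⁻ x, ‖partialDeriv i φ x‖ₑ ^ 2)) := by
  have hφc : Continuous φ := hφ.continuous
  have hint : Integrable φ := hφc.integrable_of_hasCompactSupport hc
  have hjm : Measurable fun p : EuclideanSpace ℝ ι × EuclideanSpace ℝ ι =>
      ‖φ (p.1 + p.2) - φ p.1‖ₑ ^ 2 :=
    (Continuous.enorm (by fun_prop)).measurable.pow_const 2
  have hin : ∀ k, ∀ x ∈ Q k, ∫⁻ y in Q k, ‖φ y - φ x‖ₑ ^ 2 ≤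
      ∫⁻ t in B, ‖φ (x + t) - φ x‖ₑ ^ 2 := by
    intro k x hx
    rw [← lintegral_indicator (hQm k), ← lintegral_indicator hB,
      ← lintegral_add_left_eq_self _ x]
    refine lintegral_mono fun t => ?_
    by_cases ht : x + t ∈ Q k
    · have : t ∈ B := by simpa using hQr k x hx _ ht
      simp [Set.indicator, ht, this]
    · simp [Set.indicator, ht]
  calc ∑ k ∈ s, ∫⁻ x in Q k, ‖φ x - ⨍ y in Q k, φ y‖ₑ ^ 2
      ≤ ∑ k ∈ s, v⁻¹ * ∫⁻ x in Q k, ∫⁻ t in B, ‖φ (x + t) - φ x‖ₑ ^ 2 := by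
        refine Finset.sum_le_sum fun k _ => ?_
        refine (lintegral_sq_enorm_sub_average_le (by rwa [hQv]) (by rwa [hQv])
          hint.integrableOn hφc.measurable).trans ?_
        rw [hQv]
        gcongr v⁻¹ * ?_
        exact setLIntegral_mono' (hQm k) (hin k)
    _ = v⁻¹ * ∫⁻ x in ⋃ k ∈ s, Q k, ∫⁻ t in B, ‖φ (x + t) - φ x‖ₑ ^ 2 := by
        rw [← Finset.mul_sum, lintegral_biUnion_finset (fun a _ b _ hab => hd hab)
          (fun k _ => hQm k)]
    _ ≤ v⁻¹ * ∫⁻ x, ∫⁻ t in B, ‖φ (x + t) - φ x‖ₑ ^ 2 := by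
        gcongr
        exact Measure.restrict_le_self
    _ = v⁻¹ * ∫⁻ t in B, ∫⁻ x, ‖φ (x + t) - φ x‖ₑ ^ 2 := by
        rw [lintegral_lintegral_swap hjm.aemeasurable]
    _ ≤ v⁻¹ * ∫⁻ t in B, r * ∑ i, ∫⁻ x, ‖partialDeriv i φ x‖ₑ ^ 2 := by
        gcongr v⁻¹ * ?_
        refine setLIntegral_mono' hB fun t ht => ?_
        refine (lintegral_sq_enorm_translate_sub_le hφ t).trans ?_
        gcongr
        exact hBr t ht
    _ = _ := by rw [setLIntegral_const, mul_comm (volume B)]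

/-! ### Approximation by step functions on a grid -/

/-- The half-open grid cube of side `h` with index `k`: the points `x` with `⌊xᵢ / h⌋ = kᵢ`. -/
def gridCell {ι : Type*} (h : ℝ) (k : ι → ℤ) : Set (EuclideanSpace ℝ ι) :=
  {x | ∀ i, ⌊x i / h⌋ = k i}

theorem gridCell_eq_preimage {ι : Type*} {h : ℝ} (hh : 0 < h) (k : ι → ℤ) :
    gridCell h k = WithLp.ofLp ⁻¹'
      Set.pi Set.univ fun i => Set.Ico (h * k i) (h * (k i + 1)) := by
  ext x
  simp only [gridCell, Set.mem_ofPred_eq, Set.mem_preimage, Set.mem_pi, Set.mem_univ, true_imp_iff,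
    Set.mem_Ico, Int.floor_eq_iff]
  refine forall_congr' fun i => ?_
  rw [le_div_iff₀ hh, div_lt_iff₀ hh, mul_comm h, mul_comm h]

theorem measurableSet_gridCell {ι : Type*} [Fintype ι] {h : ℝ} (hh : 0 < h) (k : ι → ℤ) :
    MeasurableSet (gridCell h k) := by
  rw [gridCell_eq_preimage hh]
  exact (PiLp.volume_preserving_ofLp ι).measurable
    (MeasurableSet.univ_pi fun i => measurableSet_Ico)

theorem volume_gridCell {ι : Type*} [Fintype ι] {h : ℝ} (hh : 0 < h) (k : ι → ℤ) :
    volume (gridCell h k) = ENNReal.ofReal h ^ Fintype.card ι := by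
  rw [gridCell_eq_preimage hh, (PiLp.volume_preserving_ofLp ι).measure_preimage
    (MeasurableSet.univ_pi fun i => measurableSet_Ico).nullMeasurableSet, Real.volume_pi_Ico]
  simp [mul_add]

theorem pairwise_disjoint_gridCell {ι : Type*} (h : ℝ) :
    Pairwise (Function.onFun Disjoint (gridCell (ι := ι) h)) := by
  intro k l hkl
  refine Set.disjoint_left.2 fun x hx hy => hkl ?_
  funext i
  rw [← hx i, ← hy i]

/-- Oscillation bound on the grid of side `h`, the sum being taken over finitely many cubes. -/
theorem sum_gridCell_lintegral_le {ι : Type*} [Fintype ι] [DecidableEq ι] {h : ℝ} (hh : 0 < h)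
    (s : Finset (ι → ℤ))
    {φ : EuclideanSpace ℝ ι → ℝ} (hφ : ContDiff ℝ 1 φ) (hc : HasCompactSupport φ) :
    ∑ k ∈ s, ∫⁻ x in gridCell h k, ‖φ x - ⨍ y in gridCell h k, φ y‖ₑ ^ 2 ≤
      ENNReal.ofReal (2 ^ Fintype.card ι * Fintype.card ι * h ^ 2) *
        ∑ i, ∫⁻ x, ‖partialDeriv i φ x‖ₑ ^ 2 := by
  set n := Fintype.card ι with hn
  set B : Set (EuclideanSpace ℝ ι) := WithLp.ofLp ⁻¹'
      Set.pi Set.univ fun _ => Set.Icc (-h) h with hBdef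
  have hpm : MeasurableSet (Set.pi Set.univ fun _ : ι => Set.Icc (-h) h) :=
    MeasurableSet.univ_pi fun i => measurableSet_Icc
  have hB : MeasurableSet B := (PiLp.volume_preserving_ofLp ι).measurable hpm
  have hvB : volume B = ENNReal.ofReal (2 * h) ^ n := by
    rw [hBdef, (PiLp.volume_preserving_ofLp ι).measure_preimage hpm.nullMeasurableSet,
      volume_pi_pi]
    simp [two_mul, hn]
  have hBr : ∀ t ∈ B, ‖t‖ₑ ^ 2 ≤ ENNReal.ofReal (n * h ^ 2) := by
    intro t ht
    rw [← ofReal_norm, ← ENNReal.ofReal_pow (norm_nonneg _), EuclideanSpace.real_norm_sq_eq]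
    refine ENNReal.ofReal_le_ofReal ?_
    calc ∑ i, t i ^ 2 ≤ ∑ _i : ι, h ^ 2 := Finset.sum_le_sum fun i _ =>
          sq_le_sq' (ht i trivial).1 (ht i trivial).2
      _ = n * h ^ 2 := by simp [hn]
  have hQ : ∀ k : ι → ℤ, ∀ x ∈ gridCell h k, ∀ y ∈ gridCell h k, y - x ∈ B := by
    intro k x hx y hy
    rw [gridCell_eq_preimage hh] at hx hy
    intro i _
    have h1 := hx i trivial
    have h2 := hy i trivial
    simp only [Set.mem_Ico] at h1 h2
    simp only [PiLp.sub_apply, Set.mem_Icc]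
    constructor <;> nlinarith [h1.1, h1.2, h2.1, h2.2]
  have h0 : ENNReal.ofReal h ≠ 0 := by simpa using hh
  refine (sum_lintegral_sq_enorm_sub_average_le s (measurableSet_gridCell hh)
    (pairwise_disjoint_gridCell h) (pow_ne_zero _ h0) (ENNReal.pow_ne_top ENNReal.ofReal_ne_top)
    (volume_gridCell hh) hB hBr hQ hφ hc).trans (le_of_eq ?_)
  rw [hvB, ← mul_assoc, ← mul_assoc, ← ENNReal.ofReal_pow hh.le, ← ENNReal.ofReal_pow (by positivity),
    ← ENNReal.ofReal_inv_of_pos (by positivity), ← ENNReal.ofReal_mul (by positivity),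
    ← ENNReal.ofReal_mul (by positivity)]
  congr 2
  rw [mul_pow]
  field_simp
  rw [hn]

theorem enorm_sq_eq_lintegral {α : Type*} [MeasurableSpace α] {μ : Measure α} (f : Lp ℝ 2 μ)
    {φ : α → ℝ} (h : f =ᵐ[μ] φ) : ‖f‖ₑ ^ 2 = ∫⁻ x, ‖φ x‖ₑ ^ 2 ∂μ := by
  rw [Lp.enorm_def, eLpNorm_congr_ae h]
  have := eLpNorm_nnreal_pow_eq_lintegral (f := φ) (μ := μ) (p := 2) (by norm_num)
  simpa using this

theorem IsTestFunction.partialDeriv_eq_zero {ι : Type*} [Fintype ι] [DecidableEq ι]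
    {Ω : Set (EuclideanSpace ℝ ι)} {φ : EuclideanSpace ℝ ι → ℝ} (h : IsTestFunction Ω φ) (i : ι)
    {x : EuclideanSpace ℝ ι} (hx : x ∉ Ω) : partialDeriv i φ x = 0 := by
  have : fderiv ℝ φ x = 0 := by
    by_contra hne
    exact hx (h.2.2 (support_fderiv_subset ℝ hne))
  simp [partialDeriv, this]

/-- Step functions on a grid approximate test functions in `L²(Ω)`, with an error controlled by
the mesh and the Dirichlet energy. -/
theorem exists_finiteDimensional_approx {ι : Type*} [Fintype ι] [DecidableEq ι]
    {Ω : Set (EuclideanSpace ℝ ι)} (hΩ : MeasurableSet Ω) (hb : Bornology.IsBounded Ω) :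
    ∃ A : ℝ, 0 < A ∧ ∀ m : ℕ, 0 < m → ∃ W : Submodule ℝ (L2 Ω),
      FiniteDimensional ℝ W ∧ Module.finrank ℝ W ≤ (2 * m) ^ Fintype.card ι ∧
      ∀ p ∈ testGraph Ω, ∃ w ∈ W, ‖p.1 - w‖ ^ 2 ≤ A / m ^ 2 * ∑ i, ‖p.2 i‖ ^ 2 := by
  classical
  obtain ⟨R, hR0, hR⟩ : ∃ R : ℝ, 0 < R ∧ ∀ x ∈ Ω, ‖x‖ < R := by
    obtain ⟨R, hR0, hR⟩ := hb.exists_pos_norm_lt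
    exact ⟨R, hR0, hR⟩
  set n := Fintype.card ι with hn
  -- The summand `1` keeps the constant positive in dimension `0`.
  refine ⟨2 ^ n * n * R ^ 2 + 1, by positivity, fun m hm => ?_⟩
  have hm' : (0 : ℝ) < m := by exact_mod_cast hm
  set h : ℝ := R / m with hh
  have hh0 : 0 < h := by positivity
  -- The cubes with indices in `[-m, m)ⁿ` cover `[-R, R)ⁿ`, hence `Ω`.
  set K : Finset (ι → ℤ) := Fintype.piFinset fun _ => Finset.Ico (-m : ℤ) m with hK
  have hKc : K.card = (2 * m) ^ n := by
    rw [hK, Fintype.card_piFinset]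
    have : ((m : ℤ) + m).toNat = m + m := by omega
    simp [hn, two_mul, this]
  have hcover : ∀ x ∈ Ω, ∃ k ∈ K, x ∈ gridCell h k := by
    intro x hx
    refine ⟨fun i => ⌊x i / h⌋, ?_, fun i => rfl⟩
    rw [hK, Fintype.mem_piFinset]
    intro i
    have hxi : |x i| < R := (PiLp.norm_apply_le x i).trans_lt (hR x hx)
    rw [abs_lt] at hxi
    have hmh : m * h = R := by rw [hh]; field_simp
    rw [Finset.mem_Ico]
    constructor
    · rw [Int.le_floor, le_div_iff₀ hh0]
      push_cast
      nlinarith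
    · rw [Int.floor_lt, div_lt_iff₀ hh0]
      push_cast
      nlinarith
  have hmeas : ∀ k : ι → ℤ, MeasurableSet (gridCell h k) := measurableSet_gridCell hh0
  have hfin : ∀ k : ι → ℤ, (volume.restrict Ω) (gridCell h k) ≠ ∞ := fun k =>
    ((Measure.le_iff'.1 Measure.restrict_le_self _).trans_lt
      (by rw [volume_gridCell hh0]; exact (ENNReal.pow_ne_top ENNReal.ofReal_ne_top).lt_top)).ne
  let e : (ι → ℤ) → L2 Ω := fun k => indicatorConstLp 2 (hmeas k) (hfin k) (1 : ℝ)
  refine ⟨Submodule.span ℝ (K.image e : Set (L2 Ω)),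
    FiniteDimensional.span_finset ℝ _, ?_, ?_⟩
  · exact (finrank_span_finset_le_card _).trans (Finset.card_image_le.trans hKc.le)
  · rintro ⟨f, G⟩ ⟨φ, hφ, hf, hG⟩
    let c : (ι → ℤ) → ℝ := fun k => ⨍ y in gridCell h k, φ y
    have hw : ((∑ k ∈ K, c k • e k : L2 Ω) : EuclideanSpace ℝ ι → ℝ) =ᵐ[volume.restrict Ω]
        fun x => ∑ k ∈ K, (gridCell h k).indicator (fun _ => c k) x := by
      have h1 := Lp.coeFn_finsetSum (p := 2) (μ := volume.restrict Ω) K fun k => c k • e k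
      have h2 : ∀ k : K, ((c k • e k : L2 Ω) : EuclideanSpace ℝ ι → ℝ) =ᵐ[volume.restrict Ω]
          (gridCell h k.1).indicator (fun _ => c k) := by
        intro k
        filter_upwards [Lp.coeFn_smul (c k) (e k),
          indicatorConstLp_coeFn (p := 2) (hs := hmeas k) (hμs := hfin k) (c := (1 : ℝ))]
          with x hx1 hx2
        rw [hx1, Pi.smul_apply, hx2]
        simp [Set.indicator]
      filter_upwards [h1, ae_all_iff.2 h2] with x hx1 hx2
      rw [hx1, Finset.sum_apply]
      exact Finset.sum_congr rfl fun k hk => hx2 ⟨k, hk⟩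
    refine ⟨∑ k ∈ K, c k • e k, Submodule.sum_mem _ fun k hk => Submodule.smul_mem _ _
      (Submodule.subset_span (Finset.mem_coe.2 (Finset.mem_image_of_mem e hk))), ?_⟩
    have hcell : ∀ k ∈ K, ∀ x ∈ gridCell h k,
        ∑ l ∈ K, (gridCell h l).indicator (fun _ => c l) x = c k := by
      intro k hk x hx
      rw [Finset.sum_eq_single k]
      · simp [hx]
      · intro l _ hlk
        exact Set.indicator_of_notMem
          (fun hxl => Set.disjoint_left.1 (pairwise_disjoint_gridCell h hlk) hxl hx) _
      · exact fun hk' => (hk' hk).elim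
    have hsub : ((f - ∑ k ∈ K, c k • e k : L2 Ω) : EuclideanSpace ℝ ι → ℝ)
        =ᵐ[volume.restrict Ω]
        fun x => φ x - ∑ k ∈ K, (gridCell h k).indicator (fun _ => c k) x := by
      filter_upwards [Lp.coeFn_sub f (∑ k ∈ K, c k • e k), hf, hw] with x h1 h2 h3
      rw [h1, Pi.sub_apply, h2, h3]
    -- The gradient of `φ` vanishes off `Ω`, so its integral over the whole space is one over `Ω`.
    have hgrad : ∀ i, ∫⁻ x, ‖partialDeriv i φ x‖ₑ ^ 2 = ‖G i‖ₑ ^ 2 := by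
      intro i
      rw [enorm_sq_eq_lintegral (G i) (hG i), ← lintegral_indicator hΩ]
      refine lintegral_congr fun x => ?_
      by_cases hx : x ∈ Ω
      · simp [hx]
      · simp [hx, hφ.partialDeriv_eq_zero i hx]
    have hφ1 : ContDiff ℝ 1 φ := hφ.1.of_le (by exact_mod_cast le_top)
    have key : ‖f - ∑ k ∈ K, c k • e k‖ₑ ^ 2 ≤
        ENNReal.ofReal (2 ^ n * n * h ^ 2) * ∑ i, ‖G i‖ₑ ^ 2 := by
      rw [enorm_sq_eq_lintegral _ hsub]
      calc ∫⁻ x in Ω, ‖φ x - ∑ k ∈ K, (gridCell h k).indicator (fun _ => c k) x‖ₑ ^ 2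
          ≤ ∫⁻ x in ⋃ k ∈ K, gridCell h k,
            ‖φ x - ∑ k ∈ K, (gridCell h k).indicator (fun _ => c k) x‖ₑ ^ 2 := by
            refine lintegral_mono_set fun x hx => ?_
            obtain ⟨k, hk, hxk⟩ := hcover x hx
            exact Set.mem_biUnion hk hxk
        _ = ∑ k ∈ K, ∫⁻ x in gridCell h k,
            ‖φ x - ∑ k ∈ K, (gridCell h k).indicator (fun _ => c k) x‖ₑ ^ 2 :=
            lintegral_biUnion_finset (fun a _ b _ hab => pairwise_disjoint_gridCell h hab)
              (fun k _ => hmeas k) _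
        _ = ∑ k ∈ K, ∫⁻ x in gridCell h k, ‖φ x - c k‖ₑ ^ 2 := by
            refine Finset.sum_congr rfl fun k hk => setLIntegral_congr_fun (hmeas k) fun x hx => ?_
            simp only [hcell k hk x hx]
        _ ≤ _ := (sum_gridCell_lintegral_le hh0 K hφ1 hφ.2.1).trans
            (by simp only [hgrad]; exact le_rfl)
    have hreal : ‖f - ∑ k ∈ K, c k • e k‖ ^ 2 ≤ 2 ^ n * n * h ^ 2 * ∑ i, ‖G i‖ ^ 2 := by
      simp only [← ofReal_norm] at key
      simp only [← ENNReal.ofReal_pow (norm_nonneg _)] at key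
      rw [← ENNReal.ofReal_sum_of_nonneg (fun i _ => sq_nonneg _),
        ← ENNReal.ofReal_mul (by positivity)] at key
      exact (ENNReal.ofReal_le_ofReal_iff (by positivity)).1 key
    refine hreal.trans ?_
    gcongr
    rw [hh, div_pow, ← mul_div_assoc]
    gcongr
    linarith

/-! ### The space `H₀¹(Ω)` and the counting of eigenvalues -/

section DirichletForm

variable {ι : Type*} [Fintype ι] [DecidableEq ι] {Ω : Set (EuclideanSpace ℝ ι)}

omit [DecidableEq ι] in
theorem IsTestFunction.contDiff_one {φ : EuclideanSpace ℝ ι → ℝ} (h : IsTestFunction Ω φ) :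
    ContDiff ℝ 1 φ :=
  h.1.of_le (by exact_mod_cast le_top)

omit [DecidableEq ι] in
theorem IsTestFunction.differentiable {φ : EuclideanSpace ℝ ι → ℝ} (h : IsTestFunction Ω φ) :
    Differentiable ℝ φ :=
  h.contDiff_one.differentiable (by norm_num)

theorem IsTestFunction.continuous_partialDeriv {φ : EuclideanSpace ℝ ι → ℝ}
    (h : IsTestFunction Ω φ) (i : ι) : Continuous (partialDeriv i φ) :=
  (h.contDiff_one.continuous_fderiv (by norm_num)).clm_apply continuous_const

theorem IsTestFunction.hasCompactSupport_partialDeriv {φ : EuclideanSpace ℝ ι → ℝ}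
    (h : IsTestFunction Ω φ) (i : ι) : HasCompactSupport (partialDeriv i φ) :=
  h.2.1.fderiv_apply ℝ _

omit [DecidableEq ι] in
theorem IsTestFunction.memLp {φ : EuclideanSpace ℝ ι → ℝ} (h : IsTestFunction Ω φ) :
    MemLp φ 2 (volume.restrict Ω) :=
  (h.1.continuous.memLp_of_hasCompactSupport h.2.1).restrict Ω

theorem IsTestFunction.memLp_partialDeriv {φ : EuclideanSpace ℝ ι → ℝ} (h : IsTestFunction Ω φ)
    (i : ι) : MemLp (partialDeriv i φ) 2 (volume.restrict Ω) :=
  ((h.continuous_partialDeriv i).memLp_of_hasCompactSupport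
    (h.hasCompactSupport_partialDeriv i)).restrict Ω

theorem IsTestFunction.exists_mem_testGraph {φ : EuclideanSpace ℝ ι → ℝ}
    (h : IsTestFunction Ω φ) : ∃ p ∈ testGraph Ω, p.1 =ᵐ[volume.restrict Ω] φ ∧
      ∀ i, p.2 i =ᵐ[volume.restrict Ω] partialDeriv i φ :=
  ⟨(h.memLp.toLp φ, fun i => (h.memLp_partialDeriv i).toLp _),
    ⟨φ, h, h.memLp.coeFn_toLp, fun i => (h.memLp_partialDeriv i).coeFn_toLp⟩,
    h.memLp.coeFn_toLp, fun i => (h.memLp_partialDeriv i).coeFn_toLp⟩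

theorem inner_eq_setIntegral_mul {α : Type*} [MeasurableSpace α] {μ : Measure α} (f g : Lp ℝ 2 μ)
    {ψ : α → ℝ} (h : g =ᵐ[μ] ψ) : ⟪f, g⟫ = ∫ x, f x * ψ x ∂μ := by
  rw [L2.inner_def]
  refine integral_congr_ae ?_
  filter_upwards [h] with x hx
  simp [hx, mul_comm]

variable (Ω) in
/-- `testGraph Ω` as a linear subspace of `L²(Ω) × L²(Ω)^ι`. -/
def testGraphSubmodule : Submodule ℝ (L2 Ω × (ι → L2 Ω)) where
  carrier := testGraph Ω
  zero_mem' := by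
    refine ⟨0, ⟨contDiff_const, HasCompactSupport.zero, by simp [tsupport]⟩, Lp.coeFn_zero _ _ _,
      fun i => ?_⟩
    have : partialDeriv i (0 : EuclideanSpace ℝ ι → ℝ) = 0 := by
      ext x; simp [partialDeriv]
    rw [this]
    exact Lp.coeFn_zero _ _ _
  add_mem' := by
    rintro p q ⟨φ, hφ, h1, h2⟩ ⟨ψ, hψ, h3, h4⟩
    refine ⟨φ + ψ, ⟨hφ.1.add hψ.1, hφ.2.1.add hψ.2.1, (tsupport_add φ ψ).trans
      (Set.union_subset hφ.2.2 hψ.2.2)⟩, ?_, fun i => ?_⟩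
    · filter_upwards [Lp.coeFn_add p.1 q.1, h1, h3] with x hx hx1 hx3
      change ((p.1 + q.1 : L2 Ω) : EuclideanSpace ℝ ι → ℝ) x = φ x + ψ x
      rw [hx, Pi.add_apply, hx1, hx3]
    · filter_upwards [Lp.coeFn_add (p.2 i) (q.2 i), h2 i, h4 i] with x hx hx1 hx3
      change ((p.2 i + q.2 i : L2 Ω) : EuclideanSpace ℝ ι → ℝ) x = _
      rw [hx, Pi.add_apply, hx1, hx3]
      simp [partialDeriv, fderiv_add (hφ.differentiable x) (hψ.differentiable x)]
  smul_mem' := by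
    rintro c p ⟨φ, hφ, h1, h2⟩
    refine ⟨c • φ, ⟨contDiff_const.smul hφ.1, hφ.2.1.mono' ?_, ?_⟩, ?_, fun i => ?_⟩
    · exact (Function.support_const_smul_subset c φ).trans subset_closure
    · exact (closure_mono (Function.support_const_smul_subset c φ)).trans hφ.2.2
    · filter_upwards [Lp.coeFn_smul c p.1, h1] with x hx hx1
      simp [hx, hx1]
    · filter_upwards [Lp.coeFn_smul c (p.2 i), h2 i] with x hx hx1
      simp [hx, hx1, partialDeriv, fderiv_const_smul (hφ.differentiable x)]

theorem isH10WithGradient_iff {u : L2 Ω} {G : ι → L2 Ω} :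
    IsH10WithGradient Ω u G ↔ (u, G) ∈ (testGraphSubmodule Ω).topologicalClosure :=
  Iff.rfl

theorem IsH10WithGradient.add {u v : L2 Ω} {G H : ι → L2 Ω} (hu : IsH10WithGradient Ω u G)
    (hv : IsH10WithGradient Ω v H) : IsH10WithGradient Ω (u + v) (G + H) :=
  isH10WithGradient_iff.2 (Submodule.add_mem _ (isH10WithGradient_iff.1 hu)
    (isH10WithGradient_iff.1 hv))

theorem IsH10WithGradient.smul (c : ℝ) {u : L2 Ω} {G : ι → L2 Ω} (hu : IsH10WithGradient Ω u G) :
    IsH10WithGradient Ω (c • u) (c • G) :=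
  isH10WithGradient_iff.2 (Submodule.smul_mem _ c (isH10WithGradient_iff.1 hu))

theorem isH10WithGradient_sum {κ : Type*} (s : Finset κ) {u : κ → L2 Ω} {G : κ → ι → L2 Ω}
    (h : ∀ k ∈ s, IsH10WithGradient Ω (u k) (G k)) :
    IsH10WithGradient Ω (∑ k ∈ s, u k) (∑ k ∈ s, G k) := by
  rw [isH10WithGradient_iff]
  have : (∑ k ∈ s, u k, ∑ k ∈ s, G k) = ∑ k ∈ s, (u k, G k) := by
    ext1 <;> simp [Prod.fst_sum, Prod.snd_sum]
  rw [this]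
  exact Submodule.sum_mem _ fun k hk => isH10WithGradient_iff.1 (h k hk)

/-- The weak equation may be tested against all of `H₀¹(Ω)`. -/
theorem weak_equation_of_isH10WithGradient {μ : ℝ} {u : L2 Ω} {G : ι → L2 Ω}
    (h : ∀ v : EuclideanSpace ℝ ι → ℝ, IsTestFunction Ω v →
      ∑ i, ∫ x in Ω, G i x * partialDeriv i v x = μ * ∫ x in Ω, u x * v x)
    {v : L2 Ω} {H : ι → L2 Ω} (hv : IsH10WithGradient Ω v H) :
    ∑ i, ⟪G i, H i⟫ = μ * ⟪u, v⟫ := by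
  have hcl : IsClosed {p : L2 Ω × (ι → L2 Ω) | ∑ i, ⟪G i, p.2 i⟫ = μ * ⟪u, p.1⟫} :=
    isClosed_eq (by fun_prop) (by fun_prop)
  refine closure_minimal (s := testGraph Ω) ?_ hcl hv
  rintro p ⟨φ, hφ, h1, h2⟩
  have := h φ hφ
  simp only [Set.mem_ofPred_eq]
  rw [inner_eq_setIntegral_mul u p.1 h1, ← this]
  exact Finset.sum_congr rfl fun i _ => inner_eq_setIntegral_mul _ _ (h2 i)

theorem isDirichletEigenfunction_iff {μ : ℝ} {u : L2 Ω} :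
    IsDirichletEigenfunction Ω μ u ↔ ∃ G : ι → L2 Ω, IsH10WithGradient Ω u G ∧
      ∀ v H, IsH10WithGradient Ω v H → ∑ i, ⟪G i, H i⟫ = μ * ⟪u, v⟫ := by
  refine exists_congr fun G => and_congr_right fun _ => ⟨fun h v H hv =>
    weak_equation_of_isH10WithGradient h hv, fun h v hv => ?_⟩
  obtain ⟨p, hp, h1, h2⟩ := hv.exists_mem_testGraph
  have := h p.1 p.2 (subset_closure hp)
  rw [inner_eq_setIntegral_mul u p.1 h1] at this
  rw [← this]
  exact Finset.sum_congr rfl fun i _ => (inner_eq_setIntegral_mul _ _ (h2 i)).symm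

theorem isDirichletEigenfunction_zero (μ : ℝ) : IsDirichletEigenfunction Ω μ (0 : L2 Ω) :=
  isDirichletEigenfunction_iff.2 ⟨0, isH10WithGradient_iff.2 (Submodule.zero_mem _), by simp⟩

theorem IsDirichletEigenfunction.add {μ : ℝ} {u v : L2 Ω} (hu : IsDirichletEigenfunction Ω μ u)
    (hv : IsDirichletEigenfunction Ω μ v) : IsDirichletEigenfunction Ω μ (u + v) := by
  rw [isDirichletEigenfunction_iff] at *
  obtain ⟨G, hG, h1⟩ := hu
  obtain ⟨H, hH, h2⟩ := hv
  refine ⟨G + H, hG.add hH, fun w K hw => ?_⟩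
  simp only [Pi.add_apply, inner_add_left, Finset.sum_add_distrib, h1 w K hw, h2 w K hw, mul_add]

theorem IsDirichletEigenfunction.smul {μ : ℝ} (c : ℝ) {u : L2 Ω}
    (hu : IsDirichletEigenfunction Ω μ u) : IsDirichletEigenfunction Ω μ (c • u) := by
  rw [isDirichletEigenfunction_iff] at *
  obtain ⟨G, hG, h1⟩ := hu
  refine ⟨c • G, hG.smul c, fun w K hw => ?_⟩
  simp only [Pi.smul_apply, real_inner_smul_left, ← Finset.mul_sum, h1 w K hw]
  ring

theorem IsDirichletEigenfunction.inner_eq_zero {μ ν : ℝ} (hne : μ ≠ ν) {u v : L2 Ω}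
    (hu : IsDirichletEigenfunction Ω μ u) (hv : IsDirichletEigenfunction Ω ν v) :
    ⟪u, v⟫ = 0 := by
  rw [isDirichletEigenfunction_iff] at *
  obtain ⟨G, hG, h1⟩ := hu
  obtain ⟨H, hH, h2⟩ := hv
  have h3 := h1 v H hH
  have h4 := h2 u G hG
  have e : ∑ i, ⟪G i, H i⟫ = ∑ i, ⟪H i, G i⟫ :=
    Finset.sum_congr rfl fun i _ => real_inner_comm _ _
  rw [real_inner_comm u v] at h4
  have h5 : (μ - ν) * ⟪u, v⟫ = 0 := by linarith
  exact (mul_eq_zero.1 h5).resolve_left (sub_ne_zero.2 hne)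

theorem IsDirichletEigenfunction.eigenvalue_nonneg {μ : ℝ} {u : L2 Ω} (hne : u ≠ 0)
    (hu : IsDirichletEigenfunction Ω μ u) : 0 ≤ μ := by
  obtain ⟨G, hG, h⟩ := isDirichletEigenfunction_iff.1 hu
  have h1 := h u G hG
  simp only [real_inner_self_eq_norm_sq] at h1
  have h2 : 0 < ‖u‖ ^ 2 := by positivity
  have h3 : 0 ≤ μ * ‖u‖ ^ 2 := h1 ▸ Finset.sum_nonneg fun i _ => sq_nonneg _
  exact nonneg_of_mul_nonneg_left h3 h2

/-- Every finite combination of eigenfunctions groups into one eigenfunction per eigenvalue. -/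
theorem exists_finsupp_of_mem_span {Λ : ℝ} {f : L2 Ω}
    (hf : f ∈ Submodule.span ℝ {φ : L2 Ω | ∃ μ ≤ Λ, IsDirichletEigenfunction Ω μ φ}) :
    ∃ F : ℝ →₀ L2 Ω, (∀ μ, IsDirichletEigenfunction Ω μ (F μ)) ∧ (∀ μ ∈ F.support, μ ≤ Λ) ∧
      F.sum (fun _ x => x) = f := by
  classical
  induction hf using Submodule.span_induction with
  | mem φ hφ =>
    obtain ⟨μ, hμ, h⟩ := hφ
    refine ⟨Finsupp.single μ φ, fun ν => ?_, fun ν hν => ?_, by simp⟩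
    · by_cases hν : ν = μ
      · subst hν; simpa using h
      · rw [Finsupp.single_eq_of_ne hν]; exact isDirichletEigenfunction_zero _
    · have := Finsupp.support_single_subset hν
      rw [Finset.mem_singleton] at this
      rwa [this]
  | zero => exact ⟨0, fun μ => isDirichletEigenfunction_zero μ, by simp, by simp⟩
  | add f g _ _ hf hg =>
    obtain ⟨F, h1, h2, h3⟩ := hf
    obtain ⟨F', h1', h2', h3'⟩ := hg
    refine ⟨F + F', fun μ => (h1 μ).add (h1' μ), fun μ hμ => ?_, ?_⟩
    · rcases Finset.mem_union.1 (Finsupp.support_add hμ) with h | h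
      · exact h2 μ h
      · exact h2' μ h
    · rw [Finsupp.sum_add_index' (by simp) (by simp), h3, h3']
  | smul c f _ hf =>
    obtain ⟨F, h1, h2, h3⟩ := hf
    refine ⟨c • F, fun μ => (h1 μ).smul c, fun μ hμ => h2 μ (Finsupp.support_smul hμ), ?_⟩
    rw [Finsupp.sum_smul_index' (by simp), ← h3, Finsupp.smul_sum]

/-- On the span of the eigenfunctions with eigenvalue at most `Λ`, the Dirichlet energy is at most
`Λ` times the squared `L²` norm: eigenfunctions for distinct eigenvalues are orthogonal both in
`L²` and for the energy. -/
theorem exists_energy_le_of_mem_span {Λ : ℝ} {f : L2 Ω}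
    (hf : f ∈ Submodule.span ℝ {φ : L2 Ω | ∃ μ ≤ Λ, IsDirichletEigenfunction Ω μ φ}) :
    ∃ G : ι → L2 Ω, IsH10WithGradient Ω f G ∧ ∑ i, ‖G i‖ ^ 2 ≤ Λ * ‖f‖ ^ 2 := by
  obtain ⟨F, h1, h2, rfl⟩ := exists_finsupp_of_mem_span hf
  choose G hG hGe using fun μ => isDirichletEigenfunction_iff.1 (h1 μ)
  refine ⟨∑ μ ∈ F.support, G μ, isH10WithGradient_sum _ fun μ _ => hG μ, ?_⟩
  have e1 : ∑ i, ‖(∑ μ ∈ F.support, G μ) i‖ ^ 2 =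
      ∑ μ ∈ F.support, ∑ ν ∈ F.support, μ * ⟪F μ, F ν⟫ := by
    simp only [← real_inner_self_eq_norm_sq, Finset.sum_apply, sum_inner, inner_sum]
    rw [Finset.sum_comm, Finset.sum_congr rfl fun _ _ => Finset.sum_comm, Finset.sum_comm]
    refine Finset.sum_congr rfl fun μ _ => ?_
    refine Finset.sum_congr rfl fun ν _ => ?_
    rw [hGe μ (F ν) (G ν) (hG ν)]
  have e2 : ‖F.sum fun _ x => x‖ ^ 2 = ∑ μ ∈ F.support, ∑ ν ∈ F.support, ⟪F μ, F ν⟫ := by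
    simp only [← real_inner_self_eq_norm_sq, Finsupp.sum, sum_inner, inner_sum]
    exact Finset.sum_comm
  rw [e1, e2, Finset.mul_sum]
  refine Finset.sum_le_sum fun μ hμ => ?_
  rw [Finset.mul_sum]
  refine Finset.sum_le_sum fun ν _ => ?_
  by_cases hμν : μ = ν
  · subst hμν
    exact mul_le_mul_of_nonneg_right (h2 μ hμ) real_inner_self_nonneg
  · simp [(h1 μ).inner_eq_zero hμν (h1 ν)]

theorem norm_sub_starProjection_le {E : Type*} [NormedAddCommGroup E] [InnerProductSpace ℝ E]
    (W : Submodule ℝ E) [W.HasOrthogonalProjection] (x : E) {w : E} (hw : w ∈ W) :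
    ‖x - W.starProjection x‖ ≤ ‖x - w‖ := by
  rw [Submodule.starProjection_minimal]
  exact ciInf_le ⟨0, by rintro _ ⟨x, rfl⟩; exact norm_nonneg _⟩ (⟨w, hw⟩ : W)

omit [DecidableEq ι] in
theorem isClosed_norm_sub_clm_sq_le {E : Type*} [NormedAddCommGroup E] [NormedSpace ℝ E]
    (P : E →L[ℝ] E) (A : ℝ) :
    IsClosed {p : E × (ι → E) | ‖p.1 - P p.1‖ ^ 2 ≤ A * ∑ i, ‖p.2 i‖ ^ 2} :=
  isClosed_le (by fun_prop) (by fun_prop)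

/-- The projection onto the approximating subspace is uniformly close to the identity on bounded
subsets of `H₀¹(Ω)`. -/
theorem exists_finiteDimensional_starProjection (hΩ : MeasurableSet Ω)
    (hb : Bornology.IsBounded Ω) :
    ∃ A : ℝ, 0 < A ∧ ∀ m : ℕ, 0 < m → ∃ W : Submodule ℝ (L2 Ω), ∃ _ : FiniteDimensional ℝ W,
      Module.finrank ℝ W ≤ (2 * m) ^ Fintype.card ι ∧
      ∀ u G, IsH10WithGradient Ω u G →
        ‖u - W.starProjection u‖ ^ 2 ≤ A / m ^ 2 * ∑ i, ‖G i‖ ^ 2 := by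
  obtain ⟨A, hA, h⟩ := exists_finiteDimensional_approx hΩ hb
  refine ⟨A, hA, fun m hm => ?_⟩
  obtain ⟨W, hW, hr, ha⟩ := h m hm
  refine ⟨W, hW, hr, fun u G hu => ?_⟩
  have hcl := isClosed_norm_sub_clm_sq_le (ι := ι) W.starProjection (A / m ^ 2)
  have hu' : (u, G) ∈ closure (testGraph Ω) := hu
  have hsub := closure_minimal (s := testGraph Ω) (fun p hp => ?_) hcl
  · have := hsub hu'
    rwa [Set.mem_ofPred_eq] at this
  · rw [Set.mem_ofPred_eq]
    obtain ⟨w, hw, hle⟩ := ha p hp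
    have h1 := norm_sub_starProjection_le W p.1 hw
    exact (pow_le_pow_left₀ (norm_nonneg _) h1 2).trans hle

/-- A polynomial bound on the number of eigenvalues up to `Λ`: on the span of the corresponding
eigenfunctions, the projection onto the step functions of a fine enough grid is injective. -/
theorem exists_finrank_span_le (hΩ : MeasurableSet Ω) (hb : Bornology.IsBounded Ω) :
    ∃ B : ℝ, 0 < B ∧ ∀ Λ : ℝ, 0 < Λ →
      FiniteDimensional ℝ (Submodule.span ℝ
        {φ : L2 Ω | ∃ μ ≤ Λ, IsDirichletEigenfunction Ω μ φ}) ∧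
      (Module.finrank ℝ (Submodule.span ℝ
        {φ : L2 Ω | ∃ μ ≤ Λ, IsDirichletEigenfunction Ω μ φ}) : ℝ) ≤
        (B * (1 + Λ)) ^ Fintype.card ι := by
  obtain ⟨A, hA, h⟩ := exists_finiteDimensional_starProjection hΩ hb
  refine ⟨2 * A + 2, by positivity, fun Λ hΛ => ?_⟩
  -- With `m > A Λ` the squared relative error `A Λ / m²` of the approximation is less than `1`.
  set m : ℕ := ⌊A * Λ⌋₊ + 1 with hm
  have hm0 : 0 < m := Nat.succ_pos _
  have hm1 : A * Λ < m := by rw [hm]; push_cast; exact Nat.lt_floor_add_one _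
  have hm2 : (m : ℝ) ≤ A * Λ + 1 := by
    rw [hm]; push_cast
    linarith [Nat.floor_le (show 0 ≤ A * Λ by positivity)]
  obtain ⟨W, hW, hr, ha⟩ := h m hm0
  set S := Submodule.span ℝ {φ : L2 Ω | ∃ μ ≤ Λ, IsDirichletEigenfunction Ω μ φ}
  have hm' : (1 : ℝ) ≤ m := by exact_mod_cast hm0
  have hinj : Function.Injective ((W.orthogonalProjectionOnto : L2 Ω →ₗ[ℝ] W).domRestrict S) := by
    rw [← LinearMap.ker_eq_bot, LinearMap.ker_eq_bot']
    rintro ⟨f, hf⟩ h0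
    obtain ⟨G, hG, hGe⟩ := exists_energy_le_of_mem_span hf
    have h1 := ha f G hG
    have h2 : W.starProjection f = 0 := by
      rw [Submodule.starProjection_apply]
      have : W.orthogonalProjectionOnto f = 0 := h0
      rw [this]; rfl
    rw [h2, sub_zero] at h1
    have h3 : ‖f‖ ^ 2 ≤ A / m ^ 2 * (Λ * ‖f‖ ^ 2) :=
      h1.trans (mul_le_mul_of_nonneg_left hGe (by positivity))
    have h4 : A / m ^ 2 * Λ < 1 := by
      rw [div_mul_eq_mul_div, div_lt_one (by positivity)]
      nlinarith
    have h5 : ‖f‖ ^ 2 = 0 := by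
      by_contra hne
      have : 0 < ‖f‖ ^ 2 := lt_of_le_of_ne (sq_nonneg _) (Ne.symm hne)
      nlinarith
    have : f = 0 := by simpa using h5
    simp [this]
  refine ⟨FiniteDimensional.of_injective _ hinj, ?_⟩
  have hle := (LinearMap.finrank_le_finrank_of_injective hinj).trans hr
  calc (Module.finrank ℝ S : ℝ) ≤ ((2 * m) ^ Fintype.card ι : ℕ) := by exact_mod_cast hle
    _ = (2 * m : ℝ) ^ Fintype.card ι := by push_cast; ring
    _ ≤ _ := by
      refine pow_le_pow_left₀ (by positivity) ?_ _
      nlinarith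

end DirichletForm

/-! ### The resolvent and the totality of eigenfunctions -/

section Resolvent

variable {ι : Type*} [Fintype ι] [DecidableEq ι] (Ω : Set (EuclideanSpace ℝ ι))

/-- The coordinates `u` (at `none`) and `G` (at `some i`) of a point of `L²(Ω)^{1+ι}`. -/
noncomputable def splitOption :
    PiLp 2 (fun _ : Option ι => L2 Ω) →L[ℝ] L2 Ω × (ι → L2 Ω) :=
  (PiLp.proj 2 (fun _ : Option ι => L2 Ω) none).prod
    (ContinuousLinearMap.pi fun i => PiLp.proj 2 (fun _ : Option ι => L2 Ω) (some i))

/-- The Hilbert space `H₀¹(Ω)`, realised as the closed subspace of `L²(Ω)^{1+ι}` of the pairs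
`(u, G)` with `u ∈ H₀¹(Ω)` and weak gradient `G`. -/
noncomputable def energySpace : Submodule ℝ (PiLp 2 (fun _ : Option ι => L2 Ω)) :=
  (testGraphSubmodule Ω).topologicalClosure.comap (splitOption Ω).toLinearMap

variable {Ω}

theorem mem_energySpace {p : PiLp 2 (fun _ : Option ι => L2 Ω)} :
    p ∈ energySpace Ω ↔ IsH10WithGradient Ω (p none) (fun i => p (some i)) :=
  Iff.rfl

instance completeSpace_energySpace : CompleteSpace (energySpace Ω) := by
  have : IsClosed (energySpace Ω : Set (PiLp 2 (fun _ : Option ι => L2 Ω))) :=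
    (Submodule.isClosed_topologicalClosure (testGraphSubmodule Ω)).preimage
      (splitOption Ω).continuous
  exact this.completeSpace_coe

variable (Ω) in
/-- The inclusion `H₀¹(Ω) → L²(Ω)`. -/
noncomputable def energyInclusion : energySpace Ω →L[ℝ] L2 Ω :=
  (PiLp.proj 2 (fun _ : Option ι => L2 Ω) none).comp (energySpace Ω).subtypeL

variable (Ω) in
/-- The resolvent `(1 - Δ)⁻¹` of the Dirichlet Laplacian, as the composition `J J*` for the
inclusion `J : H₀¹(Ω) → L²(Ω)`. -/
noncomputable def dirichletResolvent : L2 Ω →L[ℝ] L2 Ω :=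
  (energyInclusion Ω).comp (ContinuousLinearMap.adjoint (energyInclusion Ω))

/-- The weak form of `(1 - Δ) T f = f`. -/
theorem exists_gradient_dirichletResolvent (f : L2 Ω) :
    ∃ G : ι → L2 Ω, IsH10WithGradient Ω (dirichletResolvent Ω f) G ∧
      (∑ i, ‖G i‖ ^ 2 ≤ ‖f‖ ^ 2) ∧
      ∀ v H, IsH10WithGradient Ω v H →
        ⟪dirichletResolvent Ω f, v⟫ + ∑ i, ⟪G i, H i⟫ = ⟪f, v⟫ := by
  set p : energySpace Ω := ContinuousLinearMap.adjoint (energyInclusion Ω) f with hp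
  have heq : ∀ v H, IsH10WithGradient Ω v H →
        ⟪dirichletResolvent Ω f, v⟫ +
          ∑ i, ⟪(p : PiLp 2 (fun _ : Option ι => L2 Ω)) (some i), H i⟫ = ⟪f, v⟫ := by
    intro v H hv
    let q : PiLp 2 (fun _ : Option ι => L2 Ω) := WithLp.toLp 2 fun o => o.elim v H
    have hq : q ∈ energySpace Ω := mem_energySpace.2 hv
    have h1 : ⟪p, (⟨q, hq⟩ : energySpace Ω)⟫ = ⟪f, v⟫ := by
      rw [hp, ContinuousLinearMap.adjoint_inner_left]
      rfl
    rw [← h1, Submodule.coe_inner, PiLp.inner_apply, Fintype.sum_option]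
    rfl
  have hmem : IsH10WithGradient Ω (dirichletResolvent Ω f)
      (fun i => (p : PiLp 2 (fun _ : Option ι => L2 Ω)) (some i)) := mem_energySpace.1 p.2
  refine ⟨fun i => (p : PiLp 2 (fun _ : Option ι => L2 Ω)) (some i), hmem, ?_, heq⟩
  have h2 := heq _ _ hmem
  simp only [real_inner_self_eq_norm_sq] at h2
  have h3 := real_inner_le_norm f (dirichletResolvent Ω f)
  nlinarith [sq_nonneg (‖f‖ - ‖dirichletResolvent Ω f‖), sq_nonneg (‖dirichletResolvent Ω f‖)]

theorem dirichletResolvent_isSymmetric : (dirichletResolvent Ω).IsSymmetric := by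
  intro f g
  obtain ⟨G, hG, -, h⟩ := exists_gradient_dirichletResolvent f
  obtain ⟨H, hH, -, h'⟩ := exists_gradient_dirichletResolvent g
  have h1 := h _ _ hH
  have h2 := h' _ _ hG
  have e : ∑ i, ⟪G i, H i⟫ = ∑ i, ⟪H i, G i⟫ :=
    Finset.sum_congr rfl fun i _ => real_inner_comm _ _
  rw [real_inner_comm (dirichletResolvent Ω f)] at h2
  change ⟪dirichletResolvent Ω f, g⟫ = ⟪f, dirichletResolvent Ω g⟫
  rw [← h1, ← real_inner_comm, ← h2, e]

/-- Test functions are dense in `L²(Ω)`. -/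
theorem eq_zero_of_inner_testFunction (hΩ : IsOpen Ω) {f : L2 Ω}
    (h : ∀ p ∈ testGraph Ω, ⟪f, p.1⟫ = 0) : f = 0 := by
  have hloc : LocallyIntegrableOn f Ω volume := by
    have h1 : MemLp f 2 (volume.restrict Ω) := Lp.memLp f
    have h2 : LocallyIntegrable f (volume.restrict Ω) := h1.locallyIntegrable (by norm_num)
    intro x hx
    obtain ⟨s, hs, hi⟩ := h2 x
    refine ⟨s ∩ Ω, Filter.inter_mem (mem_nhdsWithin_of_mem_nhds hs) self_mem_nhdsWithin, ?_⟩
    rw [IntegrableOn, ← Measure.restrict_restrict_of_subset Set.inter_subset_right]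
    exact hi.mono_set Set.inter_subset_left
  have h0 := hΩ.ae_eq_zero_of_integral_contDiff_smul_eq_zero hloc fun g hg hc hs => by
    obtain ⟨p, hp, h1, -⟩ := IsTestFunction.exists_mem_testGraph (Ω := Ω) ⟨hg, hc, hs⟩
    have h2 := h p hp
    rw [inner_eq_setIntegral_mul f p.1 h1] at h2
    rw [← h2, ← setIntegral_eq_integral_of_forall_compl_eq_zero (s := Ω)]
    · simp only [smul_eq_mul, mul_comm]
    · intro x hx
      rw [image_eq_zero_of_notMem_tsupport fun hx' => hx (hs hx'), zero_smul]
  refine Lp.ext ?_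
  refine Filter.EventuallyEq.trans ?_ (Lp.coeFn_zero _ _ _).symm
  exact (ae_restrict_iff' hΩ.measurableSet).2 h0

/-- The resolvent is injective: if `J J* f = 0` then `J* f = 0`, and `f` is orthogonal to `H₀¹(Ω)`. -/
theorem eq_zero_of_dirichletResolvent_eq_zero (hΩ : IsOpen Ω) {f : L2 Ω}
    (hf : dirichletResolvent Ω f = 0) : f = 0 := by
  obtain ⟨G, hG, -, h⟩ := exists_gradient_dirichletResolvent f
  have h0 := h _ _ hG
  simp only [hf, real_inner_self_eq_norm_sq, inner_zero_right] at h0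
  have h1 : ∑ i, ‖G i‖ ^ 2 = 0 := by linarith [h0]
  have h2 : ∀ i, G i = 0 := fun i => by
    simpa using (Finset.sum_eq_zero_iff_of_nonneg fun i _ => sq_nonneg _).1 h1 i
      (Finset.mem_univ i)
  refine eq_zero_of_inner_testFunction hΩ fun p hp => ?_
  rw [← h p.1 p.2 (subset_closure hp)]
  simp [hf, h2]

/-- Rellich's theorem: the resolvent is a norm limit of operators of finite rank. -/
theorem isCompactOperator_dirichletResolvent (hΩ : MeasurableSet Ω)
    (hb : Bornology.IsBounded Ω) : IsCompactOperator (dirichletResolvent Ω) := by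
  obtain ⟨A, hA, h⟩ := exists_finiteDimensional_starProjection hΩ hb
  choose W hW _ ha using fun m : ℕ => h (m + 1) m.succ_pos
  refine isCompactOperator_of_tendsto (l := Filter.atTop)
    (F := fun m : ℕ => (W m).starProjection.comp (dirichletResolvent Ω)) ?_
    (Filter.Eventually.of_forall fun m => ?_)
  · rw [tendsto_iff_norm_sub_tendsto_zero]
    have hlim : Filter.Tendsto (fun m : ℕ => Real.sqrt A * (1 / ((m : ℝ) + 1)))
        Filter.atTop (nhds 0) := by
      simpa using tendsto_one_div_add_atTop_nhds_zero_nat.const_mul (Real.sqrt A)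
    refine squeeze_zero (fun _ => norm_nonneg _) (fun m => ?_) hlim
    refine ContinuousLinearMap.opNorm_le_bound _ (by positivity) fun f => ?_
    obtain ⟨G, hG, hle, -⟩ := exists_gradient_dirichletResolvent f
    have h1 := ha m _ G hG
    have h2 : ‖dirichletResolvent Ω f - (W m).starProjection (dirichletResolvent Ω f)‖ ^ 2 ≤
        (Real.sqrt A * (1 / ((m : ℝ) + 1)) * ‖f‖) ^ 2 := by
      refine h1.trans ?_
      rw [mul_pow, mul_pow, Real.sq_sqrt hA.le, div_pow, one_pow]
      push_cast
      rw [mul_one_div]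
      gcongr
    have h3 := abs_le_of_sq_le_sq h2 (by positivity)
    rw [← norm_neg]
    simpa using (le_abs_self _).trans h3
  · have := FiniteDimensional.proper_real (W m)
    have h1 : IsCompactOperator (W m).orthogonalProjectionOnto :=
      isCompactOperator_of_locallyCompactSpace_dom _
    exact (h1.clm_comp (W m).subtypeL).comp_clm (dirichletResolvent Ω)

/-- The Dirichlet eigenfunctions of a bounded open set span a dense subspace of `L²(Ω)`. -/
theorem eq_zero_of_inner_dirichletEigenfunction (hΩ : IsOpen Ω) (hb : Bornology.IsBounded Ω)
    {f : L2 Ω} (hf : ∀ μ φ, IsDirichletEigenfunction Ω μ φ → ⟪φ, f⟫ = 0) : f = 0 := by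
  have h := ContinuousLinearMap.orthogonalComplement_iSup_eigenspaces_eq_bot
    (isCompactOperator_dirichletResolvent hΩ.measurableSet hb) dirichletResolvent_isSymmetric
  rw [← Submodule.mem_bot ℝ, ← h, Submodule.mem_orthogonal]
  intro φ hφ
  induction hφ using Submodule.iSup_induction' with
  | zero => exact inner_zero_left _
  | add x y _ _ hx hy => rw [inner_add_left, hx, hy, add_zero]
  | mem κ φ hφ =>
    have hT : dirichletResolvent Ω φ = κ • φ := Module.End.mem_eigenspace_iff.1 hφ
    by_cases hκ : κ = 0
    · rw [hκ, zero_smul] at hT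
      rw [eq_zero_of_dirichletResolvent_eq_zero hΩ hT, inner_zero_left]
    -- `(1 - Δ)⁻¹ φ = κ φ` means `-Δ φ = (κ⁻¹ - 1) φ`.
    · refine hf (κ⁻¹ - 1) φ (isDirichletEigenfunction_iff.2 ?_)
      obtain ⟨G, hG, -, hw⟩ := exists_gradient_dirichletResolvent φ
      refine ⟨κ⁻¹ • G, ?_, fun v H hv => ?_⟩
      · have := hG.smul κ⁻¹
        rwa [hT, inv_smul_smul₀ hκ] at this
      · have h1 := hw v H hv
        rw [hT, real_inner_smul_left] at h1
        simp only [Pi.smul_apply, real_inner_smul_left, ← Finset.mul_sum]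
        field_simp
        linarith

end Resolvent

/-! ### Splitting coordinates and tensor products in `L²` -/

section Splitting

variable {ι₁ ι₂ : Type*} [Fintype ι₁] [Fintype ι₂]

/-- The linear isomorphism `z ↦ (proj₁ z, proj₂ z)` from `ℝ^{n₁ + n₂}` to `ℝ^{n₁} × ℝ^{n₂}`. -/
noncomputable def splitL : EuclideanSpace ℝ (ι₁ ⊕ ι₂) ≃L[ℝ]
    EuclideanSpace ℝ ι₁ × EuclideanSpace ℝ ι₂ :=
  LinearEquiv.toContinuousLinearEquiv
    { toFun := fun z => (proj₁ z, proj₂ z)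
      invFun := fun p => WithLp.toLp 2 (Sum.elim p.1 p.2)
      map_add' := fun _ _ => rfl
      map_smul' := fun _ _ => rfl
      left_inv := fun z => by ext i; cases i <;> rfl
      right_inv := fun _ => rfl }

theorem splitL_apply (z : EuclideanSpace ℝ (ι₁ ⊕ ι₂)) : splitL z = (proj₁ z, proj₂ z) := rfl

theorem proj₁_splitL_symm (x : EuclideanSpace ℝ ι₁) (y : EuclideanSpace ℝ ι₂) :
    proj₁ (splitL.symm (x, y)) = x := rfl

theorem proj₂_splitL_symm (x : EuclideanSpace ℝ ι₁) (y : EuclideanSpace ℝ ι₂) :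
    proj₂ (splitL.symm (x, y)) = y := rfl

theorem splitL_symm_proj (z : EuclideanSpace ℝ (ι₁ ⊕ ι₂)) :
    splitL.symm (proj₁ z, proj₂ z) = z := splitL.symm_apply_apply z

theorem contDiff_comp_splitL_symm_left {n : WithTop ℕ∞} {w : EuclideanSpace ℝ (ι₁ ⊕ ι₂) → ℝ}
    (hw : ContDiff ℝ n w) (y : EuclideanSpace ℝ ι₂) :
    ContDiff ℝ n (fun x : EuclideanSpace ℝ ι₁ => w (splitL.symm (x, y))) :=
  (hw.comp (ContinuousLinearEquiv.contDiff (splitL (ι₁ := ι₁) (ι₂ := ι₂)).symm)).comp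
    (f := fun x => (x, y)) (contDiff_prodMk_left y)

theorem contDiff_comp_splitL_symm_right {n : WithTop ℕ∞} {w : EuclideanSpace ℝ (ι₁ ⊕ ι₂) → ℝ}
    (hw : ContDiff ℝ n w) (x : EuclideanSpace ℝ ι₁) :
    ContDiff ℝ n (fun y : EuclideanSpace ℝ ι₂ => w (splitL.symm (x, y))) :=
  (hw.comp (ContinuousLinearEquiv.contDiff (splitL (ι₁ := ι₁) (ι₂ := ι₂)).symm)).comp
    (f := fun y => (x, y)) (contDiff_prodMk_right x)

theorem continuous_proj₁ : Continuous (proj₁ : EuclideanSpace ℝ (ι₁ ⊕ ι₂) → _) :=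
  continuous_fst.comp splitL.continuous

theorem continuous_proj₂ : Continuous (proj₂ : EuclideanSpace ℝ (ι₁ ⊕ ι₂) → _) :=
  continuous_snd.comp splitL.continuous

variable (ι₁ ι₂) in
/-- `proj₁` as a continuous linear map. -/
noncomputable def proj₁L : EuclideanSpace ℝ (ι₁ ⊕ ι₂) →L[ℝ] EuclideanSpace ℝ ι₁ :=
  (ContinuousLinearMap.fst ℝ _ _).comp (splitL (ι₁ := ι₁) (ι₂ := ι₂)).toContinuousLinearMap

variable (ι₁ ι₂) in
/-- `proj₂` as a continuous linear map. -/
noncomputable def proj₂L : EuclideanSpace ℝ (ι₁ ⊕ ι₂) →L[ℝ] EuclideanSpace ℝ ι₂ :=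
  (ContinuousLinearMap.snd ℝ _ _).comp (splitL (ι₁ := ι₁) (ι₂ := ι₂)).toContinuousLinearMap

theorem hasFDerivAt_proj₁ (z : EuclideanSpace ℝ (ι₁ ⊕ ι₂)) :
    HasFDerivAt proj₁ (proj₁L ι₁ ι₂) z :=
  (proj₁L ι₁ ι₂).hasFDerivAt

theorem hasFDerivAt_proj₂ (z : EuclideanSpace ℝ (ι₁ ⊕ ι₂)) :
    HasFDerivAt proj₂ (proj₂L ι₁ ι₂) z :=
  (proj₂L ι₁ ι₂).hasFDerivAt

theorem measurePreserving_splitL :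
    MeasurePreserving (splitL : EuclideanSpace ℝ (ι₁ ⊕ ι₂) → _ × _) volume
      ((volume : Measure (EuclideanSpace ℝ ι₁)).prod
        (volume : Measure (EuclideanSpace ℝ ι₂))) := by
  have h1 := PiLp.volume_preserving_ofLp (ι₁ ⊕ ι₂)
  have h2 := volume_measurePreserving_sumPiEquivProdPi (fun _ : ι₁ ⊕ ι₂ => ℝ)
  have h3 := (PiLp.volume_preserving_toLp ι₁).prod (PiLp.volume_preserving_toLp ι₂)
  exact h3.comp (h2.comp h1)

theorem measurableEmbedding_splitL :
    MeasurableEmbedding (splitL : EuclideanSpace ℝ (ι₁ ⊕ ι₂) →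
      EuclideanSpace ℝ ι₁ × EuclideanSpace ℝ ι₂) :=
  splitL.toHomeomorph.measurableEmbedding

theorem measurePreserving_splitL_restrict (Ω₁ : Set (EuclideanSpace ℝ ι₁))
    (Ω₂ : Set (EuclideanSpace ℝ ι₂)) :
    MeasurePreserving (splitL : EuclideanSpace ℝ (ι₁ ⊕ ι₂) → _ × _)
      (volume.restrict (cartesian Ω₁ Ω₂))
      ((volume.restrict Ω₁).prod (volume.restrict Ω₂)) := by
  rw [Measure.prod_restrict]
  exact measurePreserving_splitL.restrict_preimage_emb measurableEmbedding_splitL (Ω₁ ×ˢ Ω₂)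

theorem quasiMeasurePreserving_proj₁ (Ω₁ : Set (EuclideanSpace ℝ ι₁))
    (Ω₂ : Set (EuclideanSpace ℝ ι₂)) :
    Measure.QuasiMeasurePreserving (proj₁ : EuclideanSpace ℝ (ι₁ ⊕ ι₂) → _)
      (volume.restrict (cartesian Ω₁ Ω₂)) (volume.restrict Ω₁) :=
  Measure.quasiMeasurePreserving_fst.comp
    (measurePreserving_splitL_restrict Ω₁ Ω₂).quasiMeasurePreserving

theorem quasiMeasurePreserving_proj₂ (Ω₁ : Set (EuclideanSpace ℝ ι₁))
    (Ω₂ : Set (EuclideanSpace ℝ ι₂)) :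
    Measure.QuasiMeasurePreserving (proj₂ : EuclideanSpace ℝ (ι₁ ⊕ ι₂) → _)
      (volume.restrict (cartesian Ω₁ Ω₂)) (volume.restrict Ω₂) :=
  Measure.quasiMeasurePreserving_snd.comp
    (measurePreserving_splitL_restrict Ω₁ Ω₂).quasiMeasurePreserving

end Splitting

section Tensor

variable {ι₁ ι₂ : Type*} [Fintype ι₁] [Fintype ι₂]
  {Ω₁ : Set (EuclideanSpace ℝ ι₁)} {Ω₂ : Set (EuclideanSpace ℝ ι₂)}

theorem memLp_tensor (f : L2 Ω₁) (g : L2 Ω₂) :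
    MemLp (fun z : EuclideanSpace ℝ (ι₁ ⊕ ι₂) => f (proj₁ z) * g (proj₂ z)) 2
      (volume.restrict (cartesian Ω₁ Ω₂)) := by
  have h : MemLp (fun p : EuclideanSpace ℝ ι₁ × EuclideanSpace ℝ ι₂ => f p.1 * g p.2) 2
      ((volume.restrict Ω₁).prod (volume.restrict Ω₂)) := by
    have hm : AEStronglyMeasurable
        (fun p : EuclideanSpace ℝ ι₁ × EuclideanSpace ℝ ι₂ => f p.1 * g p.2)
        ((volume.restrict Ω₁).prod (volume.restrict Ω₂)) :=
      (Lp.aestronglyMeasurable f).comp_fst.mul (Lp.aestronglyMeasurable g).comp_snd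
    rw [memLp_two_iff_integrable_sq hm]
    simp only [mul_pow]
    exact (Lp.memLp f).integrable_sq.mul_prod (Lp.memLp g).integrable_sq
  exact h.comp_measurePreserving (measurePreserving_splitL_restrict Ω₁ Ω₂)

/-- The product `(x, y) ↦ f(x) g(y)` as an element of `L²(Ω₁ × Ω₂)`. -/
noncomputable def tensorLp (f : L2 Ω₁) (g : L2 Ω₂) : L2 (cartesian Ω₁ Ω₂) :=
  (memLp_tensor f g).toLp _

theorem coeFn_tensorLp (f : L2 Ω₁) (g : L2 Ω₂) :
    tensorLp f g =ᵐ[volume.restrict (cartesian Ω₁ Ω₂)]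
      fun z => f (proj₁ z) * g (proj₂ z) :=
  (memLp_tensor f g).coeFn_toLp

theorem tensorLp_ae_eq {f : L2 Ω₁} {g : L2 Ω₂} {φ : EuclideanSpace ℝ ι₁ → ℝ}
    {ψ : EuclideanSpace ℝ ι₂ → ℝ} (hf : f =ᵐ[volume.restrict Ω₁] φ)
    (hg : g =ᵐ[volume.restrict Ω₂] ψ) :
    tensorLp f g =ᵐ[volume.restrict (cartesian Ω₁ Ω₂)] fun z => φ (proj₁ z) * ψ (proj₂ z) := by
  filter_upwards [coeFn_tensorLp f g, (quasiMeasurePreserving_proj₁ Ω₁ Ω₂).ae hf,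
    (quasiMeasurePreserving_proj₂ Ω₁ Ω₂).ae hg] with z h1 h2 h3
  rw [h1, h2, h3]

theorem inner_tensorLp (f f' : L2 Ω₁) (g g' : L2 Ω₂) :
    ⟪tensorLp f g, tensorLp f' g'⟫ = ⟪f, f'⟫ * ⟪g, g'⟫ := by
  rw [inner_eq_setIntegral_mul f f' (Filter.EventuallyEq.refl _ _),
    inner_eq_setIntegral_mul g g' (Filter.EventuallyEq.refl _ _), ← integral_prod_mul,
    ← (measurePreserving_splitL_restrict Ω₁ Ω₂).integral_comp measurableEmbedding_splitL,
    inner_eq_setIntegral_mul _ _ (coeFn_tensorLp f' g')]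
  refine integral_congr_ae ?_
  filter_upwards [coeFn_tensorLp f g] with z hz
  rw [hz, splitL_apply]
  ring

theorem norm_tensorLp (f : L2 Ω₁) (g : L2 Ω₂) : ‖tensorLp f g‖ = ‖f‖ * ‖g‖ := by
  have h := inner_tensorLp f f g g
  simp only [real_inner_self_eq_norm_sq] at h
  rw [← mul_pow] at h
  exact (pow_left_inj₀ (norm_nonneg _) (by positivity) two_ne_zero).1 h

variable (Ω₁ Ω₂) in
/-- `tensorLp` as a continuous bilinear map. -/
noncomputable def tensorL : L2 Ω₁ →L[ℝ] L2 Ω₂ →L[ℝ] L2 (cartesian Ω₁ Ω₂) :=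
  LinearMap.mkContinuous₂
    (LinearMap.mk₂ ℝ (fun (f : L2 Ω₁) (g : L2 Ω₂) => tensorLp f g)
      (fun f f' g => by
        refine Lp.ext ?_
        filter_upwards [tensorLp_ae_eq (Lp.coeFn_add f f') (Filter.EventuallyEq.refl _ g),
          Lp.coeFn_add (tensorLp f g) (tensorLp f' g), coeFn_tensorLp f g, coeFn_tensorLp f' g]
          with z h1 h2 h3 h4
        rw [h1, h2, Pi.add_apply, Pi.add_apply, h3, h4, add_mul])
      (fun c f g => by
        refine Lp.ext ?_
        filter_upwards [tensorLp_ae_eq (Lp.coeFn_smul c f) (Filter.EventuallyEq.refl _ g),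
          Lp.coeFn_smul c (tensorLp f g), coeFn_tensorLp f g] with z h1 h2 h3
        rw [h1, h2, Pi.smul_apply, Pi.smul_apply, h3, smul_eq_mul, smul_eq_mul, mul_assoc])
      (fun f g g' => by
        refine Lp.ext ?_
        filter_upwards [tensorLp_ae_eq (Filter.EventuallyEq.refl _ f) (Lp.coeFn_add g g'),
          Lp.coeFn_add (tensorLp f g) (tensorLp f g'), coeFn_tensorLp f g, coeFn_tensorLp f g']
          with z h1 h2 h3 h4
        rw [h1, h2, Pi.add_apply, Pi.add_apply, h3, h4, mul_add])
      (fun c f g => by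
        refine Lp.ext ?_
        filter_upwards [tensorLp_ae_eq (Filter.EventuallyEq.refl _ f) (Lp.coeFn_smul c g),
          Lp.coeFn_smul c (tensorLp f g), coeFn_tensorLp f g] with z h1 h2 h3
        rw [h1, h2, Pi.smul_apply, Pi.smul_apply, h3, smul_eq_mul, smul_eq_mul, mul_left_comm]))
    1 (fun f g => by rw [one_mul]; exact (norm_tensorLp f g).le)

theorem tensorL_apply (f : L2 Ω₁) (g : L2 Ω₂) : tensorL Ω₁ Ω₂ f g = tensorLp f g := rfl

theorem isFiniteMeasure_restrict_of_isBounded {ι : Type*} [Fintype ι]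
    {Ω : Set (EuclideanSpace ℝ ι)} (hb : Bornology.IsBounded Ω) :
    IsFiniteMeasure ((volume : Measure (EuclideanSpace ℝ ι)).restrict Ω) :=
  ⟨by rw [Measure.restrict_apply_univ]; exact hb.measure_lt_top⟩

/-- Products span a dense subspace of `L²(Ω₁ × Ω₂)`, because measurable rectangles generate the
Borel sets. -/
theorem eq_zero_of_inner_tensorLp (hb₁ : Bornology.IsBounded Ω₁) (hb₂ : Bornology.IsBounded Ω₂)
    {F : L2 (cartesian Ω₁ Ω₂)} (hF : ∀ (f : L2 Ω₁) (g : L2 Ω₂), ⟪F, tensorLp f g⟫ = 0) :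
    F = 0 := by
  have h₁ := isFiniteMeasure_restrict_of_isBounded hb₁
  have h₂ := isFiniteMeasure_restrict_of_isBounded hb₂
  set μ := (volume : Measure (EuclideanSpace ℝ (ι₁ ⊕ ι₂))).restrict (cartesian Ω₁ Ω₂) with hμ
  have hfin : IsFiniteMeasure μ := ⟨by
    rw [← Set.preimage_univ (f := splitL), (measurePreserving_splitL_restrict Ω₁ Ω₂).measure_preimage
      MeasurableSet.univ.nullMeasurableSet]
    exact measure_lt_top _ _⟩
  have hint : Integrable F μ := (Lp.memLp F).integrable (by norm_num)
  have hmeas := (measurePreserving_splitL_restrict Ω₁ Ω₂).measurable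
  have hrect : ∀ (A : Set (EuclideanSpace ℝ ι₁)) (B : Set (EuclideanSpace ℝ ι₂)),
      MeasurableSet A → MeasurableSet B → ∫ z in splitL ⁻¹' (A ×ˢ B), F z ∂μ = 0 := by
    intro A B hA hB
    rw [← hF (indicatorConstLp 2 hA (measure_ne_top _ _) 1)
      (indicatorConstLp 2 hB (measure_ne_top _ _) 1),
      inner_eq_setIntegral_mul _ _ (tensorLp_ae_eq indicatorConstLp_coeFn indicatorConstLp_coeFn),
      ← integral_indicator (hmeas (hA.prod hB))]
    refine integral_congr_ae (Filter.Eventually.of_forall fun z => ?_)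
    by_cases h1 : proj₁ z ∈ A <;> by_cases h2 : proj₂ z ∈ B <;>
      simp [Set.indicator, splitL_apply, h1, h2]
  have hall : ∀ S : Set (EuclideanSpace ℝ ι₁ × EuclideanSpace ℝ ι₂), MeasurableSet S →
      ∫ z in splitL ⁻¹' S, F z ∂μ = 0 := by
    intro S hS
    induction S, hS using MeasurableSpace.induction_on_inter generateFrom_prod.symm
      isPiSystem_prod with
    | empty => simp
    | basic S hS =>
      obtain ⟨A, hA, B, hB, rfl⟩ := hS
      exact hrect A B hA hB
    | compl S hS ih =>
      have h0 := hrect Set.univ Set.univ MeasurableSet.univ MeasurableSet.univ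
      rw [Set.univ_prod_univ, Set.preimage_univ, setIntegral_univ] at h0
      rw [Set.preimage_compl, setIntegral_compl (hmeas hS) hint, h0, ih, sub_zero]
    | iUnion S hd hS ih =>
      rw [Set.preimage_iUnion, integral_iUnion (fun i => hmeas (hS i))
        (fun i j hij => (hd hij).preimage _) hint.integrableOn]
      simp [ih]
  refine Lp.ext ((hint.ae_eq_zero_of_forall_setIntegral_eq_zero fun s hs _ => ?_).trans
    (Lp.coeFn_zero _ _ _).symm)
  have := hall (splitL.symm ⁻¹' s) (splitL.symm.continuous.measurable hs)
  rwa [← Set.preimage_comp, show (splitL.symm ∘ splitL : EuclideanSpace ℝ (ι₁ ⊕ ι₂) → _) = id from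
    funext fun z => splitL.symm_apply_apply z, Set.preimage_id] at this

end Tensor

/-! ### Tensor products and the Dirichlet Laplacian -/

section TensorDirichlet

variable {ι₁ ι₂ : Type*} [Fintype ι₁] [Fintype ι₂] [DecidableEq ι₁] [DecidableEq ι₂]
  {Ω₁ : Set (EuclideanSpace ℝ ι₁)} {Ω₂ : Set (EuclideanSpace ℝ ι₂)}

omit [Fintype ι₁] [Fintype ι₂] [DecidableEq ι₁] [DecidableEq ι₂] in
theorem mem_cartesian {z : EuclideanSpace ℝ (ι₁ ⊕ ι₂)} :
    z ∈ cartesian Ω₁ Ω₂ ↔ proj₁ z ∈ Ω₁ ∧ proj₂ z ∈ Ω₂ :=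
  Iff.rfl

omit [Fintype ι₁] [Fintype ι₂] in
theorem proj₁_single_inl (i : ι₁) :
    proj₁ (EuclideanSpace.single (Sum.inl i : ι₁ ⊕ ι₂) (1 : ℝ)) = EuclideanSpace.single i 1 := by
  ext k
  simp [proj₁]

omit [Fintype ι₁] [Fintype ι₂] in
theorem proj₂_single_inl (i : ι₁) :
    proj₂ (EuclideanSpace.single (Sum.inl i : ι₁ ⊕ ι₂) (1 : ℝ)) = 0 := by
  ext k
  simp [proj₂]

omit [Fintype ι₁] [Fintype ι₂] in
theorem proj₁_single_inr (j : ι₂) :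
    proj₁ (EuclideanSpace.single (Sum.inr j : ι₁ ⊕ ι₂) (1 : ℝ)) = 0 := by
  ext k
  simp [proj₁]

omit [Fintype ι₁] [Fintype ι₂] in
theorem proj₂_single_inr (j : ι₂) :
    proj₂ (EuclideanSpace.single (Sum.inr j : ι₁ ⊕ ι₂) (1 : ℝ)) = EuclideanSpace.single j 1 := by
  ext k
  simp [proj₂]

theorem splitL_symm_single_left (i : ι₁) :
    splitL.symm ((EuclideanSpace.single i (1 : ℝ), 0) : _ × EuclideanSpace ℝ ι₂) =
      EuclideanSpace.single (Sum.inl i) 1 := by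
  rw [ContinuousLinearEquiv.symm_apply_eq, splitL_apply, proj₁_single_inl, proj₂_single_inl]

theorem splitL_symm_single_right (j : ι₂) :
    splitL.symm ((0, EuclideanSpace.single j (1 : ℝ)) : EuclideanSpace ℝ ι₁ × _) =
      EuclideanSpace.single (Sum.inr j) 1 := by
  rw [ContinuousLinearEquiv.symm_apply_eq, splitL_apply, proj₁_single_inr, proj₂_single_inr]

omit [DecidableEq ι₁] [DecidableEq ι₂] in
theorem fderiv_tensor {φ : EuclideanSpace ℝ ι₁ → ℝ} {ψ : EuclideanSpace ℝ ι₂ → ℝ}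
    (hφ : Differentiable ℝ φ) (hψ : Differentiable ℝ ψ) (z v : EuclideanSpace ℝ (ι₁ ⊕ ι₂)) :
    fderiv ℝ (fun z => φ (proj₁ z) * ψ (proj₂ z)) z v =
      φ (proj₁ z) * fderiv ℝ ψ (proj₂ z) (proj₂ v) +
        ψ (proj₂ z) * fderiv ℝ φ (proj₁ z) (proj₁ v) := by
  have h1 : HasFDerivAt (fun z => φ (proj₁ z)) _ z :=
    (hφ (proj₁ z)).hasFDerivAt.comp z (hasFDerivAt_proj₁ z)
  have h2 : HasFDerivAt (fun z => ψ (proj₂ z)) _ z :=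
    (hψ (proj₂ z)).hasFDerivAt.comp z (hasFDerivAt_proj₂ z)
  have h3 : HasFDerivAt (fun z => φ (proj₁ z) * ψ (proj₂ z)) _ z := h1.mul h2
  rw [h3.fderiv]
  rfl

omit [DecidableEq ι₁] [DecidableEq ι₂] in
theorem IsTestFunction.tensor {φ : EuclideanSpace ℝ ι₁ → ℝ} {ψ : EuclideanSpace ℝ ι₂ → ℝ}
    (hφ : IsTestFunction Ω₁ φ) (hψ : IsTestFunction Ω₂ ψ) :
    IsTestFunction (cartesian Ω₁ Ω₂) (fun z => φ (proj₁ z) * ψ (proj₂ z)) := by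
  set K : Set (EuclideanSpace ℝ (ι₁ ⊕ ι₂)) := splitL ⁻¹' (tsupport φ ×ˢ tsupport ψ) with hK
  have hKc : IsCompact K :=
    splitL.toHomeomorph.isCompact_preimage.2 (hφ.2.1.isCompact.prod hψ.2.1.isCompact)
  have hsupp : Function.support (fun z : EuclideanSpace ℝ (ι₁ ⊕ ι₂) =>
      φ (proj₁ z) * ψ (proj₂ z)) ⊆ K := by
    intro z hz
    exact ⟨subset_tsupport φ (left_ne_zero_of_mul hz), subset_tsupport ψ (right_ne_zero_of_mul hz)⟩
  refine ⟨?_, HasCompactSupport.of_support_subset_isCompact hKc hsupp,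
    (closure_minimal hsupp hKc.isClosed).trans fun z hz => ⟨hφ.2.2 hz.1, hψ.2.2 hz.2⟩⟩
  exact (hφ.1.comp (proj₁L ι₁ ι₂).contDiff).mul (hψ.1.comp (proj₂L ι₁ ι₂).contDiff)

theorem IsH10WithGradient.tensor {u : L2 Ω₁} {G : ι₁ → L2 Ω₁} {v : L2 Ω₂} {H : ι₂ → L2 Ω₂}
    (hu : IsH10WithGradient Ω₁ u G) (hv : IsH10WithGradient Ω₂ v H) :
    IsH10WithGradient (cartesian Ω₁ Ω₂) (tensorLp u v)
      (Sum.elim (fun i => tensorLp (G i) v) (fun j => tensorLp u (H j))) := by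
  let T : (L2 Ω₁ × (ι₁ → L2 Ω₁)) → (L2 Ω₂ × (ι₂ → L2 Ω₂)) →
      L2 (cartesian Ω₁ Ω₂) × (ι₁ ⊕ ι₂ → L2 (cartesian Ω₁ Ω₂)) := fun p q =>
    (tensorL Ω₁ Ω₂ p.1 q.1, Sum.elim (fun i => tensorL Ω₁ Ω₂ (p.2 i) q.1)
      (fun j => tensorL Ω₁ Ω₂ p.1 (q.2 j)))
  have hT : Continuous (Function.uncurry T) := by
    refine Continuous.prodMk (by fun_prop) (continuous_pi fun k => ?_)
    cases k with
    | inl i => simp only [Sum.elim_inl]; fun_prop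
    | inr j => simp only [Sum.elim_inr]; fun_prop
  have hu' : (u, G) ∈ closure (testGraph Ω₁) := hu
  have hv' : (v, H) ∈ closure (testGraph Ω₂) := hv
  suffices h : ∀ p ∈ testGraph Ω₁, ∀ q ∈ testGraph Ω₂, T p q ∈ testGraph (cartesian Ω₁ Ω₂) by
    have h' := map_mem_closure₂ (f := T) hT hu' hv' h
    exact h'
  rintro p ⟨φ, hφ, hp1, hp2⟩ q ⟨ψ, hψ, hq1, hq2⟩
  refine ⟨_, hφ.tensor hψ, tensorLp_ae_eq hp1 hq1, fun k => ?_⟩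
  cases k with
  | inl i =>
    refine (tensorLp_ae_eq (hp2 i) hq1).trans (Filter.Eventually.of_forall fun z => ?_)
    simp only [partialDeriv]
    rw [fderiv_tensor hφ.differentiable hψ.differentiable, proj₁_single_inl, proj₂_single_inl,
      map_zero, mul_zero, zero_add, mul_comm]
  | inr j =>
    refine (tensorLp_ae_eq hp1 (hq2 j)).trans (Filter.Eventually.of_forall fun z => ?_)
    simp only [partialDeriv]
    rw [fderiv_tensor hφ.differentiable hψ.differentiable, proj₁_single_inr, proj₂_single_inr,
      map_zero, mul_zero, add_zero]

omit [DecidableEq ι₁] [DecidableEq ι₂] in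
theorem IsTestFunction.slice_left {w : EuclideanSpace ℝ (ι₁ ⊕ ι₂) → ℝ}
    (hw : IsTestFunction (cartesian Ω₁ Ω₂) w) (y : EuclideanSpace ℝ ι₂) :
    IsTestFunction Ω₁ (fun x => w (splitL.symm (x, y))) := by
  have hK : IsCompact (proj₁ '' tsupport w) := hw.2.1.isCompact.image continuous_proj₁
  have hsupp : Function.support (fun x => w (splitL.symm (x, y))) ⊆ proj₁ '' tsupport w := by
    intro x hx
    rw [Function.mem_support] at hx
    exact ⟨_, subset_tsupport w (Function.mem_support.2 hx), proj₁_splitL_symm x y⟩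
  have hsub : proj₁ '' tsupport w ⊆ Ω₁ := by
    rw [Set.image_subset_iff]
    intro z hz
    exact (mem_cartesian.1 (hw.2.2 hz)).1
  have hsm : ContDiff ℝ (⊤ : ℕ∞) (fun x => w (splitL.symm (x, y))) :=
    contDiff_comp_splitL_symm_left hw.1 y
  exact ⟨hsm, HasCompactSupport.of_support_subset_isCompact hK hsupp,
    (closure_minimal hsupp hK.isClosed).trans hsub⟩

omit [DecidableEq ι₁] [DecidableEq ι₂] in
theorem IsTestFunction.slice_right {w : EuclideanSpace ℝ (ι₁ ⊕ ι₂) → ℝ}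
    (hw : IsTestFunction (cartesian Ω₁ Ω₂) w) (x : EuclideanSpace ℝ ι₁) :
    IsTestFunction Ω₂ (fun y => w (splitL.symm (x, y))) := by
  have hK : IsCompact (proj₂ '' tsupport w) := hw.2.1.isCompact.image continuous_proj₂
  have hsupp : Function.support (fun y => w (splitL.symm (x, y))) ⊆ proj₂ '' tsupport w := by
    intro y hy
    rw [Function.mem_support] at hy
    exact ⟨_, subset_tsupport w (Function.mem_support.2 hy), proj₂_splitL_symm x y⟩
  have hsub : proj₂ '' tsupport w ⊆ Ω₂ := by
    rw [Set.image_subset_iff]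
    intro z hz
    exact (mem_cartesian.1 (hw.2.2 hz)).2
  have hsm : ContDiff ℝ (⊤ : ℕ∞) (fun y => w (splitL.symm (x, y))) :=
    contDiff_comp_splitL_symm_right hw.1 x
  exact ⟨hsm, HasCompactSupport.of_support_subset_isCompact hK hsupp,
    (closure_minimal hsupp hK.isClosed).trans hsub⟩

theorem partialDeriv_slice_left {w : EuclideanSpace ℝ (ι₁ ⊕ ι₂) → ℝ} (hw : Differentiable ℝ w)
    (i : ι₁) (x : EuclideanSpace ℝ ι₁) (y : EuclideanSpace ℝ ι₂) :
    partialDeriv i (fun x => w (splitL.symm (x, y))) x =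
      partialDeriv (Sum.inl i) w (splitL.symm (x, y)) := by
  have h1 : HasFDerivAt (fun x : EuclideanSpace ℝ ι₁ => splitL.symm (x, y)) _ x :=
    splitL.symm.toContinuousLinearMap.hasFDerivAt.comp x
      (hasFDerivAt_prodMk_left x y)
  have h2 : HasFDerivAt (fun x : EuclideanSpace ℝ ι₁ => w (splitL.symm (x, y))) _ x :=
    (hw _).hasFDerivAt.comp x h1
  rw [partialDeriv, partialDeriv, h2.fderiv, ← splitL_symm_single_left (ι₂ := ι₂)]
  rfl

theorem partialDeriv_slice_right {w : EuclideanSpace ℝ (ι₁ ⊕ ι₂) → ℝ} (hw : Differentiable ℝ w)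
    (j : ι₂) (x : EuclideanSpace ℝ ι₁) (y : EuclideanSpace ℝ ι₂) :
    partialDeriv j (fun y => w (splitL.symm (x, y))) y =
      partialDeriv (Sum.inr j) w (splitL.symm (x, y)) := by
  have h1 : HasFDerivAt (fun y : EuclideanSpace ℝ ι₂ => splitL.symm (x, y)) _ y :=
    splitL.symm.toContinuousLinearMap.hasFDerivAt.comp y
      (hasFDerivAt_prodMk_right x y)
  have h2 : HasFDerivAt (fun y : EuclideanSpace ℝ ι₂ => w (splitL.symm (x, y))) _ y :=
    (hw _).hasFDerivAt.comp y h1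
  rw [partialDeriv, partialDeriv, h2.fderiv, ← splitL_symm_single_right (ι₁ := ι₁)]
  rfl

omit [DecidableEq ι₁] [DecidableEq ι₂] in
theorem integrable_tensorLp_mul (f : L2 Ω₁) (g : L2 Ω₂)
    {W : EuclideanSpace ℝ (ι₁ ⊕ ι₂) → ℝ}
    (hW : MemLp W 2 (volume.restrict (cartesian Ω₁ Ω₂))) :
    Integrable (fun p : EuclideanSpace ℝ ι₁ × EuclideanSpace ℝ ι₂ =>
      f p.1 * g p.2 * W (splitL.symm p)) ((volume.restrict Ω₁).prod (volume.restrict Ω₂)) := by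
  rw [← (measurePreserving_splitL_restrict Ω₁ Ω₂).integrable_comp_emb measurableEmbedding_splitL]
  refine ((memLp_tensor f g).integrable_mul hW).congr (Filter.Eventually.of_forall fun z => ?_)
  simp [splitL_apply, splitL_symm_proj]

omit [DecidableEq ι₁] [DecidableEq ι₂] in
theorem setIntegral_tensorLp_mul (f : L2 Ω₁) (g : L2 Ω₂)
    (W : EuclideanSpace ℝ (ι₁ ⊕ ι₂) → ℝ) :
    ∫ z in cartesian Ω₁ Ω₂, tensorLp f g z * W z =
      ∫ p, f p.1 * g p.2 * W (splitL.symm p) ∂((volume.restrict Ω₁).prod (volume.restrict Ω₂)) := by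
  rw [← (measurePreserving_splitL_restrict Ω₁ Ω₂).integral_comp measurableEmbedding_splitL]
  refine integral_congr_ae ?_
  filter_upwards [coeFn_tensorLp f g] with z hz
  rw [hz, splitL_apply, splitL_symm_proj]

/-- The weak equation of `u` on the first factor, integrated over the second one. -/
theorem sum_setIntegral_tensorLp_left {μ : ℝ} {u : L2 Ω₁} {G : ι₁ → L2 Ω₁}
    (h : ∀ v : EuclideanSpace ℝ ι₁ → ℝ, IsTestFunction Ω₁ v →
      ∑ i, ∫ x in Ω₁, G i x * partialDeriv i v x = μ * ∫ x in Ω₁, u x * v x) (g : L2 Ω₂)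
    {w : EuclideanSpace ℝ (ι₁ ⊕ ι₂) → ℝ} (hw : IsTestFunction (cartesian Ω₁ Ω₂) w) :
    ∑ i, ∫ z in cartesian Ω₁ Ω₂, tensorLp (G i) g z * partialDeriv (Sum.inl i) w z =
      μ * ∫ z in cartesian Ω₁ Ω₂, tensorLp u g z * w z := by
  have hi : ∀ i, Integrable (fun p : EuclideanSpace ℝ ι₁ × EuclideanSpace ℝ ι₂ =>
      G i p.1 * g p.2 * partialDeriv (Sum.inl i) w (splitL.symm p))
      ((volume.restrict Ω₁).prod (volume.restrict Ω₂)) := fun i =>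
    integrable_tensorLp_mul (G i) g (hw.memLp_partialDeriv _)
  simp only [setIntegral_tensorLp_mul]
  rw [integral_prod_symm _ (integrable_tensorLp_mul u g hw.memLp), ← integral_const_mul,
    Finset.sum_congr rfl fun i _ => integral_prod_symm _ (hi i),
    ← integral_finsetSum _ fun i _ => (hi i).integral_prod_right]
  refine integral_congr_ae (Filter.Eventually.of_forall fun y => ?_)
  have hy := h _ (hw.slice_left y)
  simp only [partialDeriv_slice_left hw.differentiable] at hy
  have e1 : ∀ i, ∫ x in Ω₁, G i x * g y * partialDeriv (Sum.inl i) w (splitL.symm (x, y)) =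
      g y * ∫ x in Ω₁, G i x * partialDeriv (Sum.inl i) w (splitL.symm (x, y)) := fun i => by
    rw [← integral_const_mul]; congr 1; ext x; ring
  have e2 : ∫ x in Ω₁, u x * g y * w (splitL.symm (x, y)) =
      g y * ∫ x in Ω₁, u x * w (splitL.symm (x, y)) := by
    rw [← integral_const_mul]; congr 1; ext x; ring
  simp only [e1, e2, ← Finset.mul_sum, hy]
  ring

/-- The weak equation of `v` on the second factor, integrated over the first one. -/
theorem sum_setIntegral_tensorLp_right {μ : ℝ} {v : L2 Ω₂} {H : ι₂ → L2 Ω₂}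
    (h : ∀ φ : EuclideanSpace ℝ ι₂ → ℝ, IsTestFunction Ω₂ φ →
      ∑ j, ∫ y in Ω₂, H j y * partialDeriv j φ y = μ * ∫ y in Ω₂, v y * φ y) (f : L2 Ω₁)
    {w : EuclideanSpace ℝ (ι₁ ⊕ ι₂) → ℝ} (hw : IsTestFunction (cartesian Ω₁ Ω₂) w) :
    ∑ j, ∫ z in cartesian Ω₁ Ω₂, tensorLp f (H j) z * partialDeriv (Sum.inr j) w z =
      μ * ∫ z in cartesian Ω₁ Ω₂, tensorLp f v z * w z := by
  have hi : ∀ j, Integrable (fun p : EuclideanSpace ℝ ι₁ × EuclideanSpace ℝ ι₂ =>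
      f p.1 * H j p.2 * partialDeriv (Sum.inr j) w (splitL.symm p))
      ((volume.restrict Ω₁).prod (volume.restrict Ω₂)) := fun j =>
    integrable_tensorLp_mul f (H j) (hw.memLp_partialDeriv _)
  simp only [setIntegral_tensorLp_mul]
  rw [integral_prod _ (integrable_tensorLp_mul f v hw.memLp), ← integral_const_mul,
    Finset.sum_congr rfl fun j _ => integral_prod _ (hi j),
    ← integral_finsetSum _ fun j _ => (hi j).integral_prod_left]
  refine integral_congr_ae (Filter.Eventually.of_forall fun x => ?_)
  have hx := h _ (hw.slice_right x)
  simp only [partialDeriv_slice_right hw.differentiable] at hx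
  simp only [mul_assoc, integral_const_mul, ← Finset.mul_sum, hx]
  ring

/-- Separation of variables: eigenvalues add under products. -/
theorem IsDirichletEigenfunction.tensorLp {μ ν : ℝ} {u : L2 Ω₁} {v : L2 Ω₂}
    (hu : IsDirichletEigenfunction Ω₁ μ u) (hv : IsDirichletEigenfunction Ω₂ ν v) :
    IsDirichletEigenfunction (cartesian Ω₁ Ω₂) (μ + ν) (tensorLp u v) := by
  obtain ⟨G, hG, h1⟩ := hu
  obtain ⟨H, hH, h2⟩ := hv
  refine ⟨_, hG.tensor hH, fun w hw => ?_⟩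
  rw [Fintype.sum_sum_type]
  simp only [Sum.elim_inl, Sum.elim_inr]
  rw [sum_setIntegral_tensorLp_left h1 v hw, sum_setIntegral_tensorLp_right h2 u hw, add_mul]

end TensorDirichlet

/-! ### Low-frequency functions on a product -/

section LowFrequency

variable {ι : Type*} [Fintype ι] [DecidableEq ι] {Ω : Set (EuclideanSpace ℝ ι)}

theorem lowFrequencySpace_eq_span (hΩ : IsOpen Ω) (hb : Bornology.IsBounded Ω) {Λ : ℝ}
    (hΛ : 0 < Λ) : lowFrequencySpace Ω Λ =
      Submodule.span ℝ {φ : L2 Ω | ∃ μ ≤ Λ, IsDirichletEigenfunction Ω μ φ} := by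
  obtain ⟨B, -, h⟩ := exists_finrank_span_le hΩ.measurableSet hb
  have := (h Λ hΛ).1
  exact (Submodule.closed_of_finiteDimensional _).submodule_topologicalClosure_eq

theorem finiteDimensional_lowFrequencySpace (hΩ : IsOpen Ω) (hb : Bornology.IsBounded Ω) {Λ : ℝ}
    (hΛ : 0 < Λ) : FiniteDimensional ℝ (lowFrequencySpace Ω Λ) := by
  obtain ⟨B, -, h⟩ := exists_finrank_span_le hΩ.measurableSet hb
  rw [lowFrequencySpace_eq_span hΩ hb hΛ]
  exact (h Λ hΛ).1

theorem exists_finrank_lowFrequencySpace_le (hΩ : IsOpen Ω) (hb : Bornology.IsBounded Ω) :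
    ∃ B : ℝ, 0 < B ∧ ∀ Λ : ℝ, 0 < Λ →
      (Module.finrank ℝ (lowFrequencySpace Ω Λ) : ℝ) ≤ (B * (1 + Λ)) ^ Fintype.card ι := by
  obtain ⟨B, hB, h⟩ := exists_finrank_span_le hΩ.measurableSet hb
  refine ⟨B, hB, fun Λ hΛ => ?_⟩
  rw [lowFrequencySpace_eq_span hΩ hb hΛ]
  exact (h Λ hΛ).2

theorem IsDirichletEigenfunction.mem_lowFrequencySpace {μ Λ : ℝ} {φ : L2 Ω}
    (h : IsDirichletEigenfunction Ω μ φ) (hμ : μ ≤ Λ) : φ ∈ lowFrequencySpace Ω Λ :=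
  Submodule.le_topologicalClosure _ (Submodule.subset_span ⟨μ, hμ, h⟩)

theorem IsDirichletEigenfunction.inner_lowFrequencySpace {μ Λ : ℝ} {φ u : L2 Ω}
    (h : IsDirichletEigenfunction Ω μ φ) (hμ : Λ < μ) (hu : u ∈ lowFrequencySpace Ω Λ) :
    ⟪φ, u⟫ = 0 := by
  have hle : lowFrequencySpace Ω Λ ≤ (ℝ ∙ φ)ᗮ := by
    refine Submodule.topologicalClosure_minimal _ (Submodule.span_le.2 ?_)
      (Submodule.isClosed_orthogonal _)
    rintro ψ ⟨ν, hν, hψ⟩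
    exact Submodule.mem_orthogonal_singleton_iff_inner_right.2
      (h.inner_eq_zero (hν.trans_lt hμ).ne' hψ)
  exact Submodule.mem_orthogonal_singleton_iff_inner_right.1 (hle hu)

/-- Totality of the eigenfunctions, in terms of continuous linear functionals. -/
theorem clm_eq_zero_of_dirichletEigenfunction (hΩ : IsOpen Ω) (hb : Bornology.IsBounded Ω)
    (l : L2 Ω →L[ℝ] ℝ) (hl : ∀ μ φ, IsDirichletEigenfunction Ω μ φ → l φ = 0) : l = 0 := by
  have h : (InnerProductSpace.toDual ℝ (L2 Ω)).symm l = 0 :=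
    eq_zero_of_inner_dirichletEigenfunction hΩ hb fun μ φ hφ => by
      rw [real_inner_comm, InnerProductSpace.toDual_symm_apply, hl μ φ hφ]
  simpa using h

theorem spectralProjector_eq_self {Λ : ℝ} {u : L2 Ω} (hu : u ∈ lowFrequencySpace Ω Λ) :
    spectralProjector Ω Λ u = u :=
  Submodule.starProjection_eq_self_iff.2 hu

theorem spectralProjector_mem (Λ : ℝ) (u : L2 Ω) :
    spectralProjector Ω Λ u ∈ lowFrequencySpace Ω Λ :=
  Submodule.starProjection_apply_mem _ _

/-- The spectral inequality for a function that is fixed by the spectral projector. -/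
theorem SpectralInequality.exists_of_mem {ω : Set (EuclideanSpace ℝ ι)} {C β Λ : ℝ}
    (h : SpectralInequality Ω ω C β) (hΛ : 0 < Λ) {u : L2 Ω} (hu : u ∈ lowFrequencySpace Ω Λ) :
    ∃ f : EuclideanSpace ℝ ι → ℝ, ContinuousOn f Ω ∧ u =ᵐ[volume.restrict Ω] f ∧
      ENNReal.ofReal ‖u‖ ≤
        ENNReal.ofReal (C * Real.exp (C * Λ ^ β)) * ⨆ x ∈ ω, ENNReal.ofReal |f x| := by
  have := h Λ hΛ u
  rwa [spectralProjector_eq_self hu] at this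

/-- If the spectral inequality holds on the empty set, there are no low frequencies at all. -/
theorem SpectralInequality.eq_zero_of_mem {C β Λ : ℝ}
    (h : SpectralInequality Ω ∅ C β) (hΛ : 0 < Λ) {u : L2 Ω} (hu : u ∈ lowFrequencySpace Ω Λ) :
    u = 0 := by
  obtain ⟨f, -, -, h⟩ := h.exists_of_mem hΛ hu
  simpa using h

end LowFrequency

section Decomposition

variable {ι₁ ι₂ : Type*} [Fintype ι₁] [Fintype ι₂] [DecidableEq ι₁] [DecidableEq ι₂]
  {Ω₁ : Set (EuclideanSpace ℝ ι₁)} {Ω₂ : Set (EuclideanSpace ℝ ι₂)}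

/-- Products of eigenfunctions span a dense subspace of `L²(Ω₁ × Ω₂)`. -/
theorem eq_zero_of_inner_tensorLp_dirichletEigenfunction (hΩ₁ : IsOpen Ω₁)
    (hb₁ : Bornology.IsBounded Ω₁) (hΩ₂ : IsOpen Ω₂) (hb₂ : Bornology.IsBounded Ω₂)
    {F : L2 (cartesian Ω₁ Ω₂)}
    (hF : ∀ μ φ ν ψ, IsDirichletEigenfunction Ω₁ μ φ → IsDirichletEigenfunction Ω₂ ν ψ →
      ⟪F, tensorLp φ ψ⟫ = 0) : F = 0 := by
  refine eq_zero_of_inner_tensorLp hb₁ hb₂ fun f g => ?_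
  have h1 : ∀ ν ψ, IsDirichletEigenfunction Ω₂ ν ψ → ∀ f : L2 Ω₁, ⟪F, tensorLp f ψ⟫ = 0 := by
    intro ν ψ hψ f
    have := clm_eq_zero_of_dirichletEigenfunction hΩ₁ hb₁
      ((innerSL ℝ F).comp ((tensorL Ω₁ Ω₂).flip ψ)) fun μ φ hφ => hF μ φ ν ψ hφ hψ
    exact DFunLike.congr_fun this f
  have := clm_eq_zero_of_dirichletEigenfunction hΩ₂ hb₂
    ((innerSL ℝ F).comp (tensorL Ω₁ Ω₂ f)) fun ν ψ hψ => h1 ν ψ hψ f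
  exact DFunLike.congr_fun this g

/-- The low-frequency functions on the product lie in the closed span of the products of
eigenfunctions whose eigenvalues add up to at most `Λ`. -/
theorem lowFrequencySpace_cartesian_le (hΩ₁ : IsOpen Ω₁)
    (hb₁ : Bornology.IsBounded Ω₁) (hΩ₂ : IsOpen Ω₂) (hb₂ : Bornology.IsBounded Ω₂) (Λ : ℝ) :
    lowFrequencySpace (cartesian Ω₁ Ω₂) Λ ≤
      (Submodule.span ℝ {w | ∃ μ φ ν ψ, IsDirichletEigenfunction Ω₁ μ φ ∧
        IsDirichletEigenfunction Ω₂ ν ψ ∧ μ + ν ≤ Λ ∧ tensorLp φ ψ = w}).topologicalClosure := by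
  intro u hu
  set S := {w : L2 (cartesian Ω₁ Ω₂) | ∃ μ φ ν ψ, IsDirichletEigenfunction Ω₁ μ φ ∧
        IsDirichletEigenfunction Ω₂ ν ψ ∧ μ + ν ≤ Λ ∧ tensorLp φ ψ = w} with hS
  set D := (Submodule.span ℝ S).topologicalClosure with hD
  have hDc : CompleteSpace D := (Submodule.isClosed_topologicalClosure _).completeSpace_coe
  have hSD : ∀ w ∈ S, w ∈ D := fun w hw =>
    Submodule.le_topologicalClosure _ (Submodule.subset_span hw)
  have hDlow : D ≤ lowFrequencySpace (cartesian Ω₁ Ω₂) Λ := by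
    refine Submodule.topologicalClosure_mono (Submodule.span_mono ?_)
    rintro w ⟨μ, φ, ν, ψ, hφ, hψ, hle, rfl⟩
    exact ⟨μ + ν, hle, hφ.tensorLp hψ⟩
  have hp : D.starProjection u ∈ D := Submodule.starProjection_apply_mem _ _
  have h0 : u - D.starProjection u = 0 := by
    refine eq_zero_of_inner_tensorLp_dirichletEigenfunction hΩ₁ hb₁ hΩ₂ hb₂
      fun μ φ ν ψ hφ hψ => ?_
    -- Products with `μ + ν ≤ Λ` are in `D`; the others are orthogonal to all low frequencies.
    by_cases hle : μ + ν ≤ Λ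
    · exact Submodule.starProjection_inner_eq_zero u _ (hSD _ ⟨μ, φ, ν, ψ, hφ, hψ, hle, rfl⟩)
    · rw [real_inner_comm]
      exact (hφ.tensorLp hψ).inner_lowFrequencySpace (not_le.1 hle)
        (Submodule.sub_mem _ hu (hDlow hp))
  rw [sub_eq_zero.1 h0]
  exact hp

/-- A low-frequency function on the product is a finite sum of products of low-frequency
functions, the first factors running over a given orthonormal basis. -/
theorem exists_eq_sum_tensorLp (hΩ₁ : IsOpen Ω₁)
    (hb₁ : Bornology.IsBounded Ω₁) (hΩ₂ : IsOpen Ω₂) (hb₂ : Bornology.IsBounded Ω₂) {Λ : ℝ}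
    (hΛ : 0 < Λ) {κ : Type*} [Fintype κ] (b : OrthonormalBasis κ ℝ (lowFrequencySpace Ω₁ Λ))
    {u : L2 (cartesian Ω₁ Ω₂)} (hu : u ∈ lowFrequencySpace (cartesian Ω₁ Ω₂) Λ) :
    ∃ a : κ → L2 Ω₂, (∀ k, a k ∈ lowFrequencySpace Ω₂ Λ) ∧
      u = ∑ k, tensorLp (b k : L2 Ω₁) (a k) := by
  have hfd := finiteDimensional_lowFrequencySpace hΩ₂ hb₂ hΛ
  let T : (κ → lowFrequencySpace Ω₂ Λ) →ₗ[ℝ] L2 (cartesian Ω₁ Ω₂) :=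
    ∑ k, (tensorL Ω₁ Ω₂ (b k : L2 Ω₁)).toLinearMap ∘ₗ (lowFrequencySpace Ω₂ Λ).subtype ∘ₗ
      LinearMap.proj k
  have hTa : ∀ a, T a = ∑ k, tensorLp (b k : L2 Ω₁) (a k : L2 Ω₂) := fun a => by
    simp [T, LinearMap.sum_apply, tensorL_apply]
  have hmem : u ∈ LinearMap.range T := by
    have hcl : IsClosed (LinearMap.range T : Set (L2 (cartesian Ω₁ Ω₂))) :=
      Submodule.closed_of_finiteDimensional _
    refine Submodule.topologicalClosure_minimal _ (Submodule.span_le.2 ?_) hcl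
      (lowFrequencySpace_cartesian_le hΩ₁ hb₁ hΩ₂ hb₂ Λ hu)
    rintro w ⟨μ, φ, ν, ψ, hφ, hψ, hle, rfl⟩
    by_cases hφ0 : φ = 0
    · rw [hφ0, ← tensorL_apply, map_zero, zero_apply]
      exact Submodule.zero_mem _
    by_cases hψ0 : ψ = 0
    · rw [hψ0, ← tensorL_apply, map_zero]
      exact Submodule.zero_mem _
    -- Both eigenvalues are nonnegative, so each of them is at most `Λ`.
    have hμ := hφ.eigenvalue_nonneg hφ0
    have hν := hψ.eigenvalue_nonneg hψ0
    have hφm : φ ∈ lowFrequencySpace Ω₁ Λ := hφ.mem_lowFrequencySpace (by linarith)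
    have hψm : ψ ∈ lowFrequencySpace Ω₂ Λ := hψ.mem_lowFrequencySpace (by linarith)
    refine ⟨fun k => b.repr ⟨φ, hφm⟩ k • ⟨ψ, hψm⟩, ?_⟩
    have hsum : φ = ∑ k, b.repr ⟨φ, hφm⟩ k • (b k : L2 Ω₁) := by
      have := congrArg Subtype.val (b.sum_repr ⟨φ, hφm⟩)
      simpa using this.symm
    rw [hTa]
    conv_rhs => rw [hsum, ← tensorL_apply, map_sum, sum_apply]
    refine Finset.sum_congr rfl fun k _ => ?_
    rw [← tensorL_apply, Submodule.coe_smul, map_smul, map_smul, smul_apply]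
  obtain ⟨a, ha⟩ := hmem
  exact ⟨fun k => a k, fun k => (a k).2, by rw [← hTa, ha]⟩

end Decomposition

/-- Polynomial factors are absorbed by `exp(C Λ^β)`, for every `β > 0`. -/
theorem exists_polynomial_mul_exp_le {B C β : ℝ} (hB : 0 < B) (hC : 0 < C) (hβ : 0 < β) (n : ℕ) :
    ∃ C' : ℝ, 0 < C' ∧ ∀ Λ : ℝ, 0 < Λ →
      (B * (1 + Λ)) ^ n * (C * Real.exp (C * Λ ^ β)) ^ 2 ≤ C' * Real.exp (C' * Λ ^ β) := by
  -- With `k ≥ n / β`, one has `Λ ^ n ≤ (Λ ^ β) ^ k ≤ k! exp(Λ ^ β)` for `Λ ≥ 1`.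
  obtain ⟨k, hk⟩ := exists_nat_ge ((n : ℝ) / β)
  have hnk : (n : ℝ) ≤ β * k := by rwa [div_le_iff₀ hβ, mul_comm] at hk
  set M : ℝ := (2 * B) ^ n * (k.factorial + 1) * C ^ 2 with hM
  have hM0 : 0 < M := by positivity
  refine ⟨M + (2 * C + 1), by positivity, fun Λ hΛ => ?_⟩
  have hpow : (1 + Λ) ^ n ≤ 2 ^ n * ((k.factorial + 1) * Real.exp (Λ ^ β)) := by
    have hexp1 : 1 ≤ Real.exp (Λ ^ β) := Real.one_le_exp (by positivity)
    have hf1 : (0 : ℝ) < k.factorial := by positivity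
    rcases le_or_gt Λ 1 with h1 | h1
    · calc (1 + Λ) ^ n ≤ 2 ^ n := pow_le_pow_left₀ (by positivity) (by linarith) n
        _ = 2 ^ n * 1 := (mul_one _).symm
        _ ≤ _ := by gcongr; nlinarith
    · have h2 : Λ ^ n ≤ k.factorial * Real.exp (Λ ^ β) := by
        calc Λ ^ n = Λ ^ (n : ℝ) := (Real.rpow_natCast _ _).symm
          _ ≤ Λ ^ (β * k) := Real.rpow_le_rpow_of_exponent_le h1.le hnk
          _ = (Λ ^ β) ^ k := by rw [Real.rpow_mul hΛ.le, Real.rpow_natCast]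
          _ ≤ k.factorial * Real.exp (Λ ^ β) := by
            have := Real.pow_div_factorial_le_exp (Λ ^ β) (by positivity) k
            rwa [div_le_iff₀ (by positivity), mul_comm] at this
      calc (1 + Λ) ^ n ≤ (2 * Λ) ^ n := pow_le_pow_left₀ (by positivity) (by linarith) n
        _ = 2 ^ n * Λ ^ n := mul_pow _ _ _
        _ ≤ _ := by gcongr; nlinarith [Real.exp_pos (Λ ^ β)]
  have hexp : Real.exp (Λ ^ β) * Real.exp (C * Λ ^ β) ^ 2 = Real.exp ((2 * C + 1) * Λ ^ β) := by
    rw [← Real.exp_nat_mul, ← Real.exp_add]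
    congr 1
    push_cast
    ring
  calc (B * (1 + Λ)) ^ n * (C * Real.exp (C * Λ ^ β)) ^ 2
      = B ^ n * (1 + Λ) ^ n * (C ^ 2 * Real.exp (C * Λ ^ β) ^ 2) := by rw [mul_pow, mul_pow]
    _ ≤ B ^ n * (2 ^ n * ((k.factorial + 1) * Real.exp (Λ ^ β))) *
        (C ^ 2 * Real.exp (C * Λ ^ β) ^ 2) := by gcongr
    _ = M * (Real.exp (Λ ^ β) * Real.exp (C * Λ ^ β) ^ 2) := by rw [hM, mul_pow]; ring
    _ = M * Real.exp ((2 * C + 1) * Λ ^ β) := by rw [hexp]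
    _ ≤ _ := by
      have : 0 < Λ ^ β := by positivity
      exact mul_le_mul (by linarith) (Real.exp_le_exp.2
        (mul_le_mul_of_nonneg_right (by linarith) this.le)) (Real.exp_pos _).le (by positivity)

section Product

variable {ι₁ ι₂ : Type*} [Fintype ι₁] [Fintype ι₂] [DecidableEq ι₁] [DecidableEq ι₂]
  {Ω₁ : Set (EuclideanSpace ℝ ι₁)} {Ω₂ : Set (EuclideanSpace ℝ ι₂)}

/-- If the spectral inequality holds on the projection of `ω` and on every horizontal slice, it
holds on `ω`. -/
theorem SpectralInequality.of_slices (hΩ₁ : IsOpen Ω₁) (hb₁ : Bornology.IsBounded Ω₁)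
    (hΩ₂ : IsOpen Ω₂) (hb₂ : Bornology.IsBounded Ω₂) {C β : ℝ} (hC : 0 < C) (hβ : 0 < β)
    {ω : Set (EuclideanSpace ℝ (ι₁ ⊕ ι₂))} (hω : ω ⊆ cartesian Ω₁ Ω₂)
    (h₂ : SpectralInequality Ω₂ (proj₂ '' ω) C β)
    (h₁ : ∀ y ∈ proj₂ '' ω, SpectralInequality Ω₁ (horizontalSlice Ω₁ ω y) C β) :
    ∃ C' : ℝ, 0 < C' ∧ SpectralInequality (cartesian Ω₁ Ω₂) ω C' β := by
  obtain ⟨B, hB, hdim⟩ := exists_finrank_lowFrequencySpace_le hΩ₁ hb₁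
  obtain ⟨C', hC', hexp⟩ := exists_polynomial_mul_exp_le hB hC hβ (Fintype.card ι₁)
  refine ⟨C', hC', fun Λ hΛ u => ?_⟩
  have hfd := finiteDimensional_lowFrequencySpace hΩ₁ hb₁ hΛ
  set K : ℝ := C * Real.exp (C * Λ ^ β) with hK
  have hK0 : 0 < K := by positivity
  set b := stdOrthonormalBasis ℝ (lowFrequencySpace Ω₁ Λ) with hbdef
  obtain ⟨a, ha, hv⟩ := exists_eq_sum_tensorLp hΩ₁ hb₁ hΩ₂ hb₂ hΛ b (spectralProjector_mem Λ u)
  rw [hv]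
  rcases ω.eq_empty_or_nonempty with rfl | ⟨z₀, hz₀⟩
  · rw [Set.image_empty] at h₂
    have hzero : ∑ k, tensorLp (b k : L2 Ω₁) (a k) = 0 := Finset.sum_eq_zero fun k _ => by
      rw [h₂.eq_zero_of_mem hΛ (ha k), ← tensorL_apply, map_zero]
    rw [hzero]
    exact ⟨0, continuousOn_const, Lp.coeFn_zero _ _ _, by simp⟩
  -- Since `ω` is nonempty, some slice provides continuous representatives of the basis of
  -- `E_Λ(Ω₁)`.
  choose φ hφc hφe _ using fun k =>
    (h₁ _ (Set.mem_image_of_mem _ hz₀)).exists_of_mem hΛ (b k).2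
  choose α hαc hαe hαle using fun k => h₂.exists_of_mem hΛ (ha k)
  set f : EuclideanSpace ℝ (ι₁ ⊕ ι₂) → ℝ := fun z => ∑ k, φ k (proj₁ z) * α k (proj₂ z) with hf
  refine ⟨f, ?_, ?_, ?_⟩
  · refine continuousOn_finsetSum _ fun k _ => ContinuousOn.mul ?_ ?_
    · exact (hφc k).comp continuous_proj₁.continuousOn fun z hz => (mem_cartesian.1 hz).1
    · exact (hαc k).comp continuous_proj₂.continuousOn fun z hz => (mem_cartesian.1 hz).2
  · filter_upwards [Lp.coeFn_finsetSum (p := 2) Finset.univ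
      fun k => tensorLp (b k : L2 Ω₁) (a k),
      ae_all_iff.2 fun k => tensorLp_ae_eq (hφe k) (hαe k)] with z h1 h2
    rw [h1, Finset.sum_apply]
    exact Finset.sum_congr rfl fun k _ => h2 k
  set s : ℝ≥0∞ := ⨆ z ∈ ω, ENNReal.ofReal |f z| with hs
  -- On a horizontal slice, the inequality on `Ω₁` controls the vector of the `α k y`.
  have hslice : ∀ k, ∀ y ∈ proj₂ '' ω, ENNReal.ofReal |α k y| ≤ ENNReal.ofReal K * s := by
    intro k y hy
    set w : lowFrequencySpace Ω₁ Λ := ∑ l, α l y • b l with hw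
    obtain ⟨g, hgc, hge, hgle⟩ := (h₁ y hy).exists_of_mem hΛ w.2
    have hwe : (w : L2 Ω₁) =ᵐ[volume.restrict Ω₁] fun x => ∑ l, φ l x * α l y := by
      have hw' : (w : L2 Ω₁) = ∑ l, α l y • (b l : L2 Ω₁) := by simp [hw]
      rw [hw']
      filter_upwards [Lp.coeFn_finsetSum (p := 2) Finset.univ
          fun l => α l y • (b l : L2 Ω₁),
        ae_all_iff.2 fun l => Lp.coeFn_smul (α l y) (b l : L2 Ω₁), ae_all_iff.2 hφe]
        with x h1 h2 h3
      rw [h1, Finset.sum_apply]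
      refine Finset.sum_congr rfl fun l _ => ?_
      rw [h2 l, Pi.smul_apply, h3 l, smul_eq_mul, mul_comm]
    have hEq : Set.EqOn g (fun x => ∑ l, φ l x * α l y) Ω₁ :=
      Measure.eqOn_open_of_ae_eq (hge.symm.trans hwe) hΩ₁ hgc
        (continuousOn_finsetSum _ fun l _ => (hφc l).mul continuousOn_const)
    have hcoef : |α k y| ≤ ‖(w : L2 Ω₁)‖ := by
      have h1 : ⟪b k, w⟫ = α k y := by
        rw [hw, b.orthonormal.inner_right_fintype]
      have h2 := abs_real_inner_le_norm (b k) w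
      rwa [h1, b.norm_eq_one, one_mul] at h2
    refine (ENNReal.ofReal_le_ofReal hcoef).trans (hgle.trans ?_)
    gcongr
    refine iSup₂_le fun x hx => ?_
    obtain ⟨z, ⟨hzω, hzc⟩, rfl⟩ := hx
    have hz2 : proj₂ z = y := (mem_cartesian.1 hzc).2
    rw [hEq (mem_cartesian.1 hzc).1, ← hz2]
    exact le_iSup₂ (f := fun z (_ : z ∈ ω) => ENNReal.ofReal |f z|) z hzω
  have hnorm : ∀ k, ENNReal.ofReal ‖a k‖ ≤ ENNReal.ofReal (K ^ 2) * s := by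
    intro k
    refine (hαle k).trans ?_
    rw [pow_two, ENNReal.ofReal_mul hK0.le, mul_assoc]
    gcongr
    exact iSup₂_le fun y hy => hslice k y hy
  calc ENNReal.ofReal ‖∑ k, tensorLp (b k : L2 Ω₁) (a k)‖
      ≤ ENNReal.ofReal (∑ k, ‖a k‖) := by
        refine ENNReal.ofReal_le_ofReal ((norm_sum_le _ _).trans (le_of_eq ?_))
        refine Finset.sum_congr rfl fun k _ => ?_
        have : ‖(b k : L2 Ω₁)‖ = 1 := b.norm_eq_one k
        rw [norm_tensorLp, this, one_mul]
    _ = ∑ k, ENNReal.ofReal ‖a k‖ := ENNReal.ofReal_sum_of_nonneg fun k _ => norm_nonneg _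
    _ ≤ ∑ _k, ENNReal.ofReal (K ^ 2) * s := Finset.sum_le_sum fun k _ => hnorm k
    _ = ENNReal.ofReal (Module.finrank ℝ (lowFrequencySpace Ω₁ Λ) * K ^ 2) * s := by
        rw [Finset.sum_const, Finset.card_univ, Fintype.card_fin, nsmul_eq_mul, ← mul_assoc,
          ENNReal.ofReal_mul (Nat.cast_nonneg _), ENNReal.ofReal_natCast]
    _ ≤ ENNReal.ofReal (C' * Real.exp (C' * Λ ^ β)) * s := by
        gcongr ?_ * s
        refine ENNReal.ofReal_le_ofReal ?_
        exact (mul_le_mul_of_nonneg_right (hdim Λ hΛ) (sq_nonneg K)).trans (hexp Λ hΛ)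

/-- The spectral inequality passes to products. -/
theorem SpectralInequality.cartesian (hΩ₁ : IsOpen Ω₁) (hb₁ : Bornology.IsBounded Ω₁)
    (hΩ₂ : IsOpen Ω₂) (hb₂ : Bornology.IsBounded Ω₂) {C β : ℝ} (hC : 0 < C) (hβ : 0 < β)
    {ω₁ : Set (EuclideanSpace ℝ ι₁)} {ω₂ : Set (EuclideanSpace ℝ ι₂)} (hω₁ : ω₁ ⊆ Ω₁)
    (hω₂ : ω₂ ⊆ Ω₂) (h₁ : SpectralInequality Ω₁ ω₁ C β) (h₂ : SpectralInequality Ω₂ ω₂ C β) :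
    ∃ C' : ℝ, 0 < C' ∧
      SpectralInequality (_root_.cartesian Ω₁ Ω₂) (_root_.cartesian ω₁ ω₂) C' β := by
  rcases ω₁.eq_empty_or_nonempty with rfl | ⟨x₀, hx₀⟩
  -- The projection of `∅ × ω₂` is not `ω₂`, but here there are no low frequencies on `Ω₁` at all.
  · refine ⟨1, one_pos, fun Λ hΛ u => ?_⟩
    have hfd := finiteDimensional_lowFrequencySpace hΩ₁ hb₁ hΛ
    obtain ⟨a, -, hv⟩ := exists_eq_sum_tensorLp hΩ₁ hb₁ hΩ₂ hb₂ hΛ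
      (stdOrthonormalBasis ℝ (lowFrequencySpace Ω₁ Λ)) (spectralProjector_mem Λ u)
    have hzero : spectralProjector (_root_.cartesian Ω₁ Ω₂) Λ u = 0 := by
      rw [hv]
      refine Finset.sum_eq_zero fun k _ => ?_
      rw [h₁.eq_zero_of_mem hΛ (stdOrthonormalBasis ℝ (lowFrequencySpace Ω₁ Λ) k).2,
        ← tensorL_apply, map_zero, zero_apply]
    rw [hzero]
    exact ⟨0, continuousOn_const, Lp.coeFn_zero _ _ _, by simp⟩
  have hproj : proj₂ '' _root_.cartesian ω₁ ω₂ = ω₂ := by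
    refine Set.Subset.antisymm (Set.image_subset_iff.2 fun z hz => (mem_cartesian.1 hz).2)
      fun y hy => ⟨splitL.symm (x₀, y), mem_cartesian.2 ⟨?_, ?_⟩, proj₂_splitL_symm x₀ y⟩
    · rwa [proj₁_splitL_symm]
    · rwa [proj₂_splitL_symm]
  have hslice : ∀ y ∈ ω₂, horizontalSlice Ω₁ (_root_.cartesian ω₁ ω₂) y = ω₁ := by
    intro y hy
    refine Set.Subset.antisymm (Set.image_subset_iff.2 fun z hz => (mem_cartesian.1 hz.1).1)
      fun x hx => ⟨splitL.symm (x, y), ⟨mem_cartesian.2 ⟨?_, ?_⟩, mem_cartesian.2 ⟨?_, ?_⟩⟩,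
        proj₁_splitL_symm x y⟩
    · rwa [proj₁_splitL_symm]
    · rwa [proj₂_splitL_symm]
    · rw [proj₁_splitL_symm]; exact hω₁ hx
    · rw [proj₂_splitL_symm]; exact Set.mem_singleton y
  refine SpectralInequality.of_slices hΩ₁ hb₁ hΩ₂ hb₂ hC hβ
    (fun z hz => mem_cartesian.2 ⟨hω₁ (mem_cartesian.1 hz).1, hω₂ (mem_cartesian.1 hz).2⟩) ?_ ?_
  · rwa [hproj]
  · rw [hproj]
    intro y hy
    rwa [hslice y hy]

end Product

theorem mainTheorem7 (n₁ n₂ : ℕ)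
    (Ω₁ : Set (EuclideanSpace ℝ (Fin n₁))) (Ω₂ : Set (EuclideanSpace ℝ (Fin n₂)))
    (hΩ₁ : IsOpen Ω₁) (hΩ₁b : Bornology.IsBounded Ω₁)
    (hΩ₂ : IsOpen Ω₂) (hΩ₂b : Bornology.IsBounded Ω₂)
    (C β : ℝ) (hC : 0 < C) (hβ : 0 < β) :
    (∀ ω : Set (EuclideanSpace ℝ (Fin n₁ ⊕ Fin n₂)), ω ⊆ cartesian Ω₁ Ω₂ →
      SpectralInequality Ω₂ (proj₂ '' ω) C β →
      (∀ y ∈ proj₂ '' ω, SpectralInequality Ω₁ (horizontalSlice Ω₁ ω y) C β) →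
      ∃ C' : ℝ, 0 < C' ∧ SpectralInequality (cartesian Ω₁ Ω₂) ω C' β) ∧
    (∀ (ω₁ : Set (EuclideanSpace ℝ (Fin n₁))) (ω₂ : Set (EuclideanSpace ℝ (Fin n₂))),
      ω₁ ⊆ Ω₁ → ω₂ ⊆ Ω₂ →
      SpectralInequality Ω₁ ω₁ C β → SpectralInequality Ω₂ ω₂ C β →
      ∃ C' : ℝ, 0 < C' ∧ SpectralInequality (cartesian Ω₁ Ω₂) (cartesian ω₁ ω₂) C' β) :=
  ⟨fun _ hω h₂ h₁ => SpectralInequality.of_slices hΩ₁ hΩ₁b hΩ₂ hΩ₂b hC hβ hω h₂ h₁,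
    fun _ _ hω₁ hω₂ h₁ h₂ =>
      SpectralInequality.cartesian hΩ₁ hΩ₁b hΩ₂ hΩ₂b hC hβ hω₁ hω₂ h₁ h₂⟩
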